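/- Let $n\ge 2$, let $\mathbb{S}^{n-1}\subset\mathbb{R}^n$ carry the rotation invariant probability measure $d\theta$, and for every $k\ge 0$ let $Y_{k,\ell}$ ($1\le\ell\le d_k$) be a real basis of the space of harmonic homogeneous polynomials of degree $k$ on $\mathbb{R}^n$ ($d_k$ is its dimension), such that all the $Y_{k,\ell}$ together are orthonormal in $L^2(\mathbb{S}^{n-1},d\theta)$. For a signed measure $\mu$ on $\mathbb{R}^n$ of finite total variation let $\mu_{k,\ell}$ be its component measures on $[0,\infty)$, $\int F(r)\,d\mu_{k,\ell}(r)=\int_{\mathbb{R}^n}F(|x|)\,Y_{k,\ell}(x/|x|)\,d\mu(x)$ (at $x=0$ the weight $Y_{k,\ell}(x/|x|)$ is read as $Y_{k,\ell}(0)$). The measure $\mu$ is pseudo-positive if $\mu_{k,\ell}\ge 0$ for all $(k,\ell)$. Its multidimensional Stieltjes–Markov transform is $$\widehat\mu(\zeta,\theta)=\sum_{k,\ell}\zeta^{1-k}\,Y_{k,\ell}(\theta)\int_0^\infty\frac{r^k\,d\mu_{k,\ell}(r)}{\zeta^2-r^2},\qquad \zeta\in\mathbb{C},\ \theta\in\mathbb{S}^{n-1};$$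 it is called absolutely convergent at $(\zeta,\theta)$ if all these integrals converge absolutely and the series converges even with absolute values taken inside the integrals. The Klein–Dirac quadric $\mathrm{KDQ}$ is the quotient of $\mathbb{C}\times\mathbb{S}^{n-1}$ by $(\zeta,\theta)\sim(-\zeta,-\theta)$; the class of $(\zeta,\theta)$ is written $\zeta\theta$, and $B_R=\{\zeta\theta:|\zeta|<R\}$. For $\Omega\subset\mathrm{KDQ}$, the pseudo-positive Nevanlinna class on $\Omega$ consists of the functions $F(\zeta\theta)=\sum_{k,\ell}c_{k,\ell}(\zeta^2)\,\zeta^{-k}\,Y_{k,\ell}(\theta)$ ($\zeta\theta\in\Omega$), where the series converges absolutely and uniformly on compact subsets of $\Omega$ and each $c_{k,\ell}$ is analytic on $\{\zeta^2:\zeta\theta\in\Omega\}$ and on the upper half-plane, with $\operatorname{Im}c_{k,\ell}(z)\ge 0$ for $\operatorname{Im}z>0$. **Theorem.** Let $N\ge 0$. Let $\mu$ be pseudo-positive with absolutely convergent moments $$s_{k,\ell;j}=\int_{\mathbb{R}^n}|x|^{2j}\,Y_{k,\ell}(x)\,d\mu(x)\qquad\text{for all }(k,\ell)\text{ and }0\le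 j\le 2N,$$ and suppose that $|s_{k,\ell;0}|\le C D^k$ for all $(k,\ell)$, with constants $C,D>0$ independent of $(k,\ell)$. Then: 1. For every $R>0$ let $\mu_R$ be the restriction of $\mu$ to the closed ball of radius $R$. For $|\zeta|>R$ and $\theta\in\mathbb{S}^{n-1}$ the transform $\widehat{\mu_R}(\zeta,\theta)$ is absolutely convergent and equals the absolutely convergent integral $$\int\frac{\zeta^{n-1}}{r(\zeta\theta-x)^n}\,d\mu_R(x),\qquad r(\zeta\theta-x)=\zeta\sqrt{1-\tfrac{2\langle\theta,x\rangle}{\zeta}+\tfrac{|x|^2}{\zeta^2}}\quad\text{(principal root)},$$ and $-\zeta^{-1}\widehat{\mu_R}(\zeta,\theta)$ is a function of $\zeta\theta$ that belongs to the pseudo-positive Nevanlinna class on $\mathrm{KDQ}\setminus\overline{B_R}$. 2. For $|\zeta|>D$ with $\zeta^2\notin[0,\infty)$ and every $\theta\in\mathbb{S}^{n-1}$, the transform $\widehat\mu(\zeta,\theta)$ is absolutely convergent, and $\widehat\mu(\zeta,\theta)=\lim_{R\to\infty}\widehat{\mu_R}(\zeta,\theta)$. 3. The function $-\zeta^{-1}\widehat\mu(\zeta,\theta)$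 is a function of $\zeta\theta$ and belongs to the pseudo-positive Nevanlinna class on $\{\zeta\theta\in\mathrm{KDQ}\setminus\overline{B_D}:\zeta^2\notin[0,\infty)\}$. 4. For every $(k,\ell)$ the function $\theta\mapsto\widehat\mu(\zeta,\theta)Y_{k,\ell}(\theta)$ is integrable for the $\zeta$ of part 2, and for every $0\le M\le 2N$ and $0<\delta<\pi/2$ $$\lim_{\zeta\to\infty}\zeta^{k+2M+1}\Bigl\{\int_{\mathbb{S}^{n-1}}\widehat\mu(\zeta,\theta)\,Y_{k,\ell}(\theta)\,d\theta-\sum_{j=0}^{M-1}\frac{s_{k,\ell;j}}{\zeta^{k+2j+1}}\Bigr\}=s_{k,\ell;M}$$ uniformly for $\delta\le\arg\zeta^2\le\pi-\delta$. In general the limit in part 4 is not uniform in $(k,\ell)$: for all $n\ge 2$, $Y$ and $N\ge 0$ there is a pseudo-positive $\mu$ satisfying the hypotheses (with some $C,D>0$) for which, with $M=2N$ and for every $\delta\in(0,\pi/2)$, the convergence is not uniform in $(k,\ell)$ and $\zeta$ jointly. -/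

import Mathlib

open MeasureTheory Filter Topology

noncomputable section

namespace KleinDirac

/-- Euclidean `n`-space. -/
abbrev Space (n : ℕ) : Type := EuclideanSpace ℝ (Fin n)

/-- The unit sphere of `n`-space. -/
abbrev Sphere (n : ℕ) : Type := Metric.sphere (0 : Space n) 1

/-- The rotation invariant probability measure on the unit sphere. -/
def sphereMeasure (n : ℕ) : Measure (Sphere n) :=
  ((volume : Measure (Space n)).toSphere Set.univ)⁻¹ • (volume : Measure (Space n)).toSphere

/-- The Laplace operator on real polynomials in `n` variables. -/
def polyLaplacian (n : ℕ) : MvPolynomial (Fin n) ℝ →ₗ[ℝ] MvPolynomial (Fin n) ℝ :=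
  ∑ i : Fin n, (MvPolynomial.pderiv i).toLinearMap ∘ₗ (MvPolynomial.pderiv i).toLinearMap

/-- The space of harmonic polynomials which are homogeneous of degree `k`; restricted to the
sphere these are the spherical harmonics of degree `k`. -/
def solidHarmonics (n k : ℕ) : Submodule ℝ (MvPolynomial (Fin n) ℝ) :=
  MvPolynomial.homogeneousSubmodule (Fin n) ℝ k ⊓ LinearMap.ker (polyLaplacian n)

/-- The dimension `d_k` of the space of spherical harmonics of degree `k`. -/
def harmonicDim (n k : ℕ) : ℕ := Module.finrank ℝ (solidHarmonics n k)

/-- The set of all pairs `(k, ℓ)` with `k ≥ 0` and `ℓ` running through `d_k` values. -/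
abbrev HIndex (n : ℕ) : Type := Σ k : ℕ, Fin (harmonicDim n k)

/-- A real basis `Y_{k,ℓ}` of the spherical harmonics, orthonormal for the normalized surface
measure of the sphere. -/
structure HarmonicBasis (n : ℕ) where
  basis : ∀ k : ℕ, Module.Basis (Fin (harmonicDim n k)) ℝ (solidHarmonics n k)
  orthonormal : ∀ i j : HIndex n,
    ∫ θ : Sphere n,
      MvPolynomial.eval (fun m => (θ : Space n) m) (basis i.1 i.2 : MvPolynomial (Fin n) ℝ) *
      MvPolynomial.eval (fun m => (θ : Space n) m) (basis j.1 j.2 : MvPolynomial (Fin n) ℝ)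
      ∂(sphereMeasure n) = if i = j then 1 else 0

variable {n : ℕ}

/-- The solid harmonic `Y_{k,ℓ}(x)`, where `x` is any point of `n`-space. -/
def HarmonicBasis.val (Y : HarmonicBasis n) (i : HIndex n) (x : Space n) : ℝ :=
  MvPolynomial.eval (fun m => x m) (Y.basis i.1 i.2 : MvPolynomial (Fin n) ℝ)

/-- The component measure `μ_{k,ℓ}` on the half-line `r ≥ 0`: the image under `x ↦ |x|` of the
signed measure `Y_{k,ℓ}(x / |x|) dμ(x)`. At `x = 0` the weight is the value of the solid harmonic
at the origin, that is, `0` for `k ≥ 1` and the constant `Y_{0,1}` for `k = 0`. -/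
def component (Y : HarmonicBasis n) (μ : SignedMeasure (Space n)) (i : HIndex n) :
    SignedMeasure ℝ :=
  (μ.withDensity (fun x => Y.val i (‖x‖⁻¹ • x)) (ContinuousLinearMap.lsmul ℝ ℝ).flip).map
    (fun x => ‖x‖)

/-- Pseudo-positivity (on the whole space): all component measures are nonnegative. -/
def IsPseudoPositive (Y : HarmonicBasis n) (μ : SignedMeasure (Space n)) : Prop :=
  ∀ i, 0 ≤ component Y μ i

/-- The measure `μ` solves the moment problem with data `s_{k,ℓ;j}` for all `(k,ℓ)` and `j ≤ J`,
the moment integrals being absolutely convergent. -/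
def SolvesMomentProblem (Y : HarmonicBasis n) (μ : SignedMeasure (Space n))
    (s : HIndex n → ℕ → ℝ) (J : ℕ) : Prop :=
  ∀ i, ∀ j ≤ J, μ.Integrable (fun x : Space n => ‖x‖ ^ (2 * j) * Y.val i x) ∧
    s i j = ∫ᵛ x, ‖x‖ ^ (2 * j) * Y.val i x ∂<•μ

/-- The growth condition `|s_{k,ℓ;0}| ≤ C D^k`. -/
def GrowthBound (s : HIndex n → ℕ → ℝ) (C D : ℝ) : Prop :=
  ∀ i, |s i 0| ≤ C * D ^ i.1

/-- A square root of `ζ² - 2 ζ ⟨θ, x⟩ + |x|²`, in the form `ζ √(1 - 2 ⟨θ, x⟩ / ζ + |x|² / ζ²)`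
with the principal root, which is holomorphic in `ζ` for `|ζ| > |x|`, asymptotic to `ζ`. -/
def distRoot (ζ : ℂ) (θ : Sphere n) (x : Space n) : ℂ :=
  ζ * (1 - 2 * (inner ℝ (θ : Space n) x : ℝ) / ζ + (‖x‖ : ℂ) ^ 2 / ζ ^ 2) ^ (1 / 2 : ℂ)

theorem distRoot_sq {ζ : ℂ} (hζ : ζ ≠ 0) (θ : Sphere n) (x : Space n) :
    distRoot ζ θ x ^ 2 =
      ζ ^ 2 - 2 * ζ * (inner ℝ (θ : Space n) x : ℝ) + (‖x‖ : ℂ) ^ 2 := by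
  have h : ∀ w : ℂ, (w ^ (1 / 2 : ℂ)) ^ 2 = w := fun w => by
    have := Complex.cpow_nat_inv_pow w (n := 2) two_ne_zero
    simpa only [Nat.cast_ofNat, one_div] using this
  rw [distRoot, mul_pow, h]
  field_simp

/-- The Hua–Aronszajn kernel `ζ^{n-1} / r(ζθ - x)^n`. -/
def kernel (ζ : ℂ) (θ : Sphere n) (x : Space n) : ℂ :=
  ζ ^ (n - 1) / distRoot ζ θ x ^ n

/-- The one-dimensional Stieltjes transform `∫ r^k dμ_{k,ℓ}(r) / (z - r²)`. -/
def componentTransform (Y : HarmonicBasis n) (μ : SignedMeasure (Space n)) (i : HIndex n)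
    (z : ℂ) : ℂ :=
  ∫ᵛ r, (r : ℂ) ^ i.1 / (z - (r : ℂ) ^ 2) ∂<•(component Y μ i)

/-- The multidimensional Stieltjes–Markov transform, as the series
`∑ ζ^{1-k} Y_{k,ℓ}(θ) ∫ r^k dμ_{k,ℓ}(r) / (ζ² - r²)`. -/
def transform (Y : HarmonicBasis n) (μ : SignedMeasure (Space n)) (ζ : ℂ) (θ : Sphere n) : ℂ :=
  ∑' i : HIndex n, ζ ^ (1 - (i.1 : ℤ)) * (Y.val i θ : ℂ) * componentTransform Y μ i (ζ ^ 2)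

/-- Absolute convergence of the Stieltjes–Markov transform at `(ζ, θ)`: of the integrals, and of
the series, with absolute values taken inside the integrals. -/
def TransformConverges (Y : HarmonicBasis n) (μ : SignedMeasure (Space n)) (ζ : ℂ)
    (θ : Sphere n) : Prop :=
  (∀ i : HIndex n,
    (component Y μ i).Integrable (fun r : ℝ => (r : ℂ) ^ i.1 / (ζ ^ 2 - (r : ℂ) ^ 2))) ∧
  Summable (fun i : HIndex n => ‖ζ ^ (1 - (i.1 : ℤ))‖ * |Y.val i θ| *
    ∫ r, ‖(r : ℂ) ^ i.1 / (ζ ^ 2 - (r : ℂ) ^ 2)‖ ∂(component Y μ i).variation)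

/-- The antipodal identification of `(ζ, θ)` and `(-ζ, -θ)`. -/
def antipodal (n : ℕ) : Setoid (ℂ × Sphere n) where
  r p q := q = p ∨ q = (-p.1, -p.2)
  iseqv :=
    { refl := fun _ => Or.inl rfl
      symm := by
        rintro p q (rfl | rfl)
        · exact Or.inl rfl
        · exact Or.inr (by simp)
      trans := by
        rintro p q r (rfl | rfl) (rfl | rfl)
        · exact Or.inl rfl
        · exact Or.inr rfl
        · exact Or.inr rfl
        · exact Or.inl (by simp) }

/-- The Klein–Dirac quadric, with the quotient topology. -/
def KDQ (n : ℕ) : Type := Quotient (antipodal n)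

instance : TopologicalSpace (KDQ n) := inferInstanceAs (TopologicalSpace (Quotient (antipodal n)))

/-- The point `ζθ` of the Klein–Dirac quadric. -/
def KDQ.mk (ζ : ℂ) (θ : Sphere n) : KDQ n := Quotient.mk (antipodal n) (ζ, θ)

/-- The ball `B_R` of the Klein–Dirac quadric. -/
def KDQ.ball (n : ℕ) (R : ℝ) : Set (KDQ n) :=
  {q | ∃ (ζ : ℂ) (θ : Sphere n), ‖ζ‖ < R ∧ q = KDQ.mk ζ θ}

/-- The complement of the closed ball of radius `R` in the Klein–Dirac quadric. -/
def KDQ.exterior (n : ℕ) (R : ℝ) : Set (KDQ n) := (closure (KDQ.ball n R))ᶜ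

/-- The points `ζθ` for which `ζ² ∉ [0, ∞)`. -/
def KDQ.slit (n : ℕ) : Set (KDQ n) :=
  {q | ∃ (ζ : ℂ) (θ : Sphere n), (∀ t : ℝ, 0 ≤ t → ζ ^ 2 ≠ (t : ℂ)) ∧ q = KDQ.mk ζ θ}

/-- `F` is holomorphic on the subset `Ω` of the exterior of a ball of the Klein–Dirac quadric, with
components `c_{k,ℓ}`: it is represented by `∑ c_{k,ℓ}(ζ²) ζ^{-k} Y_{k,ℓ}(θ)`, where the `c_{k,ℓ}`
are analytic functions of `ζ²` for `ζθ ∈ Ω`, and the series converges absolutely and uniformly on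
the compact subsets of `Ω`. -/
structure HasHolomorphicExpansion (Y : HarmonicBasis n) (Ω : Set (KDQ n)) (F : KDQ n → ℂ)
    (c : HIndex n → ℂ → ℂ) : Prop where
  analytic : ∀ i, AnalyticOnNhd ℂ (c i) {z | ∃ (ζ : ℂ) (θ : Sphere n), KDQ.mk ζ θ ∈ Ω ∧ z = ζ ^ 2}
  hasSum : ∀ (ζ : ℂ) (θ : Sphere n), KDQ.mk ζ θ ∈ Ω →
    HasSum (fun i : HIndex n => c i (ζ ^ 2) * (1 / ζ ^ i.1) * (Y.val i θ : ℂ)) (F (KDQ.mk ζ θ))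
  absolute : ∀ K : Set (KDQ n), IsCompact K → K ⊆ Ω →
    SummableUniformlyOn
      (fun (i : HIndex n) (p : ℂ × Sphere n) =>
        ‖c i (p.1 ^ 2) * (1 / p.1 ^ i.1) * (Y.val i p.2 : ℂ)‖)
      {p | KDQ.mk p.1 p.2 ∈ K}

/-- The Nevanlinna class: analytic in the open upper half-plane with nonnegative imaginary part. -/
def nevanlinnaClass : Set (ℂ → ℂ) :=
  {f | AnalyticOnNhd ℂ f {z | 0 < z.im} ∧ ∀ z : ℂ, 0 < z.im → 0 ≤ (f z).im}

/-- The pseudo-positive Nevanlinna class on `Ω`: holomorphic functions all of whose components are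
in the Nevanlinna class. -/
def pseudoPositiveNevanlinna (Y : HarmonicBasis n) (Ω : Set (KDQ n)) : Set (KDQ n → ℂ) :=
  {F | ∃ c : HIndex n → ℂ → ℂ, HasHolomorphicExpansion Y Ω F c ∧ ∀ i, c i ∈ nevanlinnaClass}

/-- `-ζ⁻¹ μ̂(ζ, θ)` is on `Ω` a well defined function of the point `ζθ`, and belongs to the
pseudo-positive Nevanlinna class there. -/
def TransformIsNevanlinna (Y : HarmonicBasis n) (μ : SignedMeasure (Space n))
    (Ω : Set (KDQ n)) : Prop :=
  ∃ F ∈ pseudoPositiveNevanlinna Y Ω, ∀ (ζ : ℂ) (θ : Sphere n), KDQ.mk ζ θ ∈ Ω →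
    F (KDQ.mk ζ θ) = -(ζ⁻¹ * transform Y μ ζ θ)

/-- The restriction of `μ` to the closed ball of radius `R`. -/
def truncation (μ : SignedMeasure (Space n)) (R : ℝ) : SignedMeasure (Space n) :=
  μ.restrict (Metric.closedBall 0 R)

/-- The component `∫ μ̂(ζ, θ) Y_{k,ℓ}(θ) dθ` of the transform. -/
def harmonicCoefficient (Y : HarmonicBasis n) (μ : SignedMeasure (Space n)) (i : HIndex n)
    (ζ : ℂ) : ℂ :=
  ∫ θ : Sphere n, transform Y μ ζ θ * (Y.val i θ : ℂ) ∂(sphereMeasure n)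

/-- The scaled remainder
`ζ^{k+2M+1} (∫ μ̂(ζ, θ) Y_{k,ℓ}(θ) dθ - ∑_{j<M} s_{k,ℓ;j} / ζ^{k+2j+1})`. -/
def scaledRemainder (Y : HarmonicBasis n) (μ : SignedMeasure (Space n)) (s : HIndex n → ℕ → ℝ)
    (M : ℕ) (i : HIndex n) (ζ : ℂ) : ℂ :=
  ζ ^ (i.1 + 2 * M + 1) * (harmonicCoefficient Y μ i ζ -
    ∑ j ∈ Finset.range M, (s i j : ℂ) / ζ ^ (i.1 + 2 * j + 1))

/-- The sector `δ ≤ arg ζ² ≤ π - δ`. -/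
def sector (δ : ℝ) : Set ℂ := {ζ | δ ≤ (ζ ^ 2).arg ∧ (ζ ^ 2).arg ≤ Real.pi - δ}

end KleinDirac

end

/-!
Iterating the projection of `⟨η, x⟩ p(x)` onto the harmonic polynomials produces the zonal
harmonics. Multiplication by `⟨η, x⟩` is adjoint to `∂_η` in the Gaussian inner product, up to
multiples of `|x|²`, so `Z_k` reproduces the harmonic polynomials of degree `k`: this is the
addition theorem `∑_ℓ Y_{k,ℓ}(θ) Y_{k,ℓ}(x) = c_k Z_k`. The generating function of the Gegenbauer
polynomials then sums the series over `k` to the Poisson kernel, which gives the expansion of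
`ζ^{n-1} / r(ζθ - x)^n` for `|x| < |ζ|`.

For a pseudo-positive `μ` all `μ_{k,ℓ}` are positive measures, and the growth condition reads
`∫ r^k dμ_{k,ℓ} ≤ C D^k`. As `|Y_{k,ℓ}| ≤ d_k` on the sphere, the series of the transform is
dominated by a geometric series with polynomial weights as soon as `ζ²` keeps a positive distance
from the squares of the radii that `μ` charges. Each coefficient is a Cauchy transform
`-∫ r^k dμ_{k,ℓ}(r) / (z - r²)`, which maps the upper half-plane to its closure.

By orthonormality the coefficient of `Y_{k,ℓ}` in the transform is one Cauchy transform, and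
`z / (z - r²) = 1 + r² / (z - r²)` shows that the `M`-th remainder is
`∫ r^{k+2M+2} dμ_{k,ℓ} / (ζ² - r²)`, which tends to `0` in sectors by dominated convergence. When
`μ_{k,ℓ}` is the mass `r^{-k}` at a radius `r = r_k → ∞`, this remainder does not become small at
`|ζ| = r_k`.
-/

noncomputable section

namespace KleinDirac

section HarmonicPolynomials

open MvPolynomial

variable {n : ℕ}

lemma polyLaplacian_apply (p : MvPolynomial (Fin n) ℝ) :
    polyLaplacian n p = ∑ i, pderiv i (pderiv i p) := by
  simp [polyLaplacian]

lemma pderiv_comm {σ R : Type*} [CommRing R] (i j : σ) (p : MvPolynomial σ R) :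
    pderiv i (pderiv j p) = pderiv j (pderiv i p) := by
  have h : ⁅pderiv (R := R) i, pderiv (R := R) j⁆ = 0 := by
    classical
    refine derivation_ext fun m => ?_
    simp only [Derivation.commutator_apply, pderiv_X, Pi.single_apply, apply_ite (pderiv _),
      map_zero, ite_self, sub_self, Derivation.coe_zero, Pi.zero_apply,
      Derivation.map_one_eq_zero]
  exact sub_eq_zero.1 (by rw [← Derivation.commutator_apply, h, Derivation.coe_zero, Pi.zero_apply])

lemma polyLaplacian_pderiv (i : Fin n) (p : MvPolynomial (Fin n) ℝ) :
    polyLaplacian n (pderiv i p) = pderiv i (polyLaplacian n p) := by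
  simp only [polyLaplacian_apply, map_sum, pderiv_comm _ i]

lemma polyLaplacian_mul (p q : MvPolynomial (Fin n) ℝ) :
    polyLaplacian n (p * q) = polyLaplacian n p * q
      + 2 * ∑ i, pderiv i p * pderiv i q + p * polyLaplacian n q := by
  simp only [polyLaplacian_apply, Finset.mul_sum, Finset.sum_mul, ← Finset.sum_add_distrib,
    pderiv_mul, map_add]
  exact Finset.sum_congr rfl fun i _ => by ring

/-- The linear form `x ↦ ⟨η, x⟩` as a polynomial. -/
def linForm (η : Fin n → ℝ) : MvPolynomial (Fin n) ℝ := ∑ i, C (η i) * X i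

/-- The polynomial `|x|²`. -/
def sqNorm (n : ℕ) : MvPolynomial (Fin n) ℝ := ∑ i, X i * X i

/-- The derivative in the direction `η`. -/
def dirDeriv (η : Fin n → ℝ) : Derivation ℝ (MvPolynomial (Fin n) ℝ) (MvPolynomial (Fin n) ℝ) :=
  ∑ i, (C (η i) : MvPolynomial (Fin n) ℝ) • pderiv i

lemma dirDeriv_apply (η : Fin n → ℝ) (p : MvPolynomial (Fin n) ℝ) :
    dirDeriv η p = ∑ i, C (η i) * pderiv i p := by
  change Derivation.coeFnAddMonoidHom (dirDeriv η) p = _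
  rw [dirDeriv, map_sum, Finset.sum_apply]
  rfl

lemma dirDeriv_C_mul (η : Fin n → ℝ) (a : ℝ) (p : MvPolynomial (Fin n) ℝ) :
    dirDeriv η (C a * p) = C a * dirDeriv η p := by
  rw [← smul_eq_C_mul, ← smul_eq_C_mul, Derivation.map_smul]

lemma pderiv_linForm (η : Fin n → ℝ) (i : Fin n) : pderiv i (linForm η) = C (η i) := by
  simp [linForm, pderiv_X, Pi.single_apply]

lemma pderiv_sqNorm (i : Fin n) : pderiv i (sqNorm n) = 2 * X i := by
  simp [sqNorm, pderiv_X, Pi.single_apply, Finset.sum_add_distrib, two_mul]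

lemma dirDeriv_linForm {η : Fin n → ℝ} (hη : ∑ i, η i ^ 2 = 1) : dirDeriv η (linForm η) = 1 := by
  rw [dirDeriv_apply, ← C_1, ← hη, map_sum]
  exact Finset.sum_congr rfl fun i _ => by rw [pderiv_linForm, ← C_mul, sq]

lemma dirDeriv_sqNorm (η : Fin n → ℝ) : dirDeriv η (sqNorm n) = 2 * linForm η := by
  simp only [dirDeriv_apply, linForm, Finset.mul_sum, pderiv_sqNorm]
  exact Finset.sum_congr rfl fun i _ => by ring

lemma isHomogeneous_linForm (η : Fin n → ℝ) : (linForm η).IsHomogeneous 1 :=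
  IsHomogeneous.sum _ _ _ fun i _ => isHomogeneous_C_mul_X (η i) i

lemma isHomogeneous_sqNorm (n : ℕ) : (sqNorm n).IsHomogeneous 2 :=
  IsHomogeneous.sum _ _ _ fun i _ => (isHomogeneous_X ℝ i).mul (isHomogeneous_X ℝ i)

lemma isHomogeneous_dirDeriv {p : MvPolynomial (Fin n) ℝ} {k : ℕ} (hp : p.IsHomogeneous k)
    (η : Fin n → ℝ) : (dirDeriv η p).IsHomogeneous (k - 1) := by
  rw [dirDeriv_apply]
  exact IsHomogeneous.sum _ _ _ fun i _ => hp.pderiv.C_mul (η i)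

lemma polyLaplacian_dirDeriv (η : Fin n → ℝ) (p : MvPolynomial (Fin n) ℝ) :
    polyLaplacian n (dirDeriv η p) = dirDeriv η (polyLaplacian n p) := by
  simp only [dirDeriv_apply, map_sum, ← smul_eq_C_mul, map_smul, polyLaplacian_pderiv]

lemma polyLaplacian_linForm_mul (η : Fin n → ℝ) (p : MvPolynomial (Fin n) ℝ) :
    polyLaplacian n (linForm η * p) = linForm η * polyLaplacian n p + 2 * dirDeriv η p := by
  rw [polyLaplacian_mul, dirDeriv_apply]
  simp only [polyLaplacian_apply (linForm η), pderiv_linForm, pderiv_C, Finset.sum_const_zero]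
  ring

lemma polyLaplacian_sqNorm (n : ℕ) : polyLaplacian n (sqNorm n) = C (2 * n : ℝ) := by
  have (i : Fin n) : pderiv i (2 * X i : MvPolynomial (Fin n) ℝ) = C 2 := by
    rw [← map_ofNat C 2, pderiv_C_mul, pderiv_X_self, mul_one]
  simp only [polyLaplacian_apply, pderiv_sqNorm, this, Finset.sum_const, Finset.card_univ,
    Fintype.card_fin, nsmul_eq_mul, map_mul, map_natCast]
  ring

lemma polyLaplacian_sqNorm_mul {p : MvPolynomial (Fin n) ℝ} {k : ℕ} (hp : p.IsHomogeneous k) :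
    polyLaplacian n (sqNorm n * p) = sqNorm n * polyLaplacian n p + C (2 * n + 4 * k : ℝ) * p := by
  have euler : ∑ i, pderiv i (sqNorm n) * pderiv i p = 2 * (C (k : ℝ) * p) := by
    simp only [pderiv_sqNorm, mul_assoc, ← Finset.mul_sum, hp.sum_X_mul_pderiv, nsmul_eq_mul,
      map_natCast]
  rw [polyLaplacian_mul, polyLaplacian_sqNorm, euler]
  simp only [map_add, map_mul, map_ofNat, map_natCast]
  ring

lemma mem_solidHarmonics {k : ℕ} {p : MvPolynomial (Fin n) ℝ} :
    p ∈ solidHarmonics n k ↔ p.IsHomogeneous k ∧ polyLaplacian n p = 0 := by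
  simp [solidHarmonics]

lemma eq_C_of_isHomogeneous_zero {σ R : Type*} [CommSemiring R] {p : MvPolynomial σ R}
    (hp : p.IsHomogeneous 0) : p = C (coeff 0 p) :=
  totalDegree_eq_zero_iff_eq_C.1 (Nat.le_zero.1 hp.totalDegree_le)

lemma pderiv_mem_solidHarmonics {k : ℕ} {p : MvPolynomial (Fin n) ℝ}
    (hp : p ∈ solidHarmonics n k) (i : Fin n) : pderiv i p ∈ solidHarmonics n (k - 1) := by
  rw [mem_solidHarmonics] at hp ⊢
  exact ⟨hp.1.pderiv, by rw [polyLaplacian_pderiv, hp.2, map_zero]⟩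

lemma dirDeriv_mem_solidHarmonics {k : ℕ} {p : MvPolynomial (Fin n) ℝ}
    (hp : p ∈ solidHarmonics n k) (η : Fin n → ℝ) :
    dirDeriv η p ∈ solidHarmonics n (k - 1) := by
  rw [mem_solidHarmonics] at hp ⊢
  exact ⟨isHomogeneous_dirDeriv hp.1 η, by rw [polyLaplacian_dirDeriv, hp.2, map_zero]⟩

lemma eval_dirDeriv_self {p : MvPolynomial (Fin n) ℝ} {k : ℕ} (hp : p.IsHomogeneous k)
    (η : Fin n → ℝ) : eval η (dirDeriv η p) = k * eval η p := by
  simpa [dirDeriv_apply] using congrArg (eval η) hp.sum_X_mul_pderiv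

/-- The harmonic component of `⟨η, x⟩ p(x)`, for a solid harmonic `p` of degree `k`. The
denominator vanishes for `k = 0` and `n = 2`; there the subtracted term is zero anyway. -/
def raise (η : Fin n → ℝ) (k : ℕ) (p : MvPolynomial (Fin n) ℝ) : MvPolynomial (Fin n) ℝ :=
  linForm η * p - C (1 / (2 * k + n - 2) : ℝ) * (sqNorm n * dirDeriv η p)

lemma raise_C (η : Fin n → ℝ) (k : ℕ) (a : ℝ) : raise η k (C a) = C a * linForm η := by
  rw [raise, dirDeriv_apply]
  simp [mul_comm]

lemma isHomogeneous_raise (η : Fin n → ℝ) {k : ℕ} {p : MvPolynomial (Fin n) ℝ}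
    (hp : p.IsHomogeneous k) : (raise η k p).IsHomogeneous (k + 1) := by
  rcases k with _ | k
  · rw [eq_C_of_isHomogeneous_zero hp, raise_C]
    exact (isHomogeneous_linForm η).C_mul _
  · refine (homogeneousSubmodule (Fin n) ℝ (k + 1 + 1)).sub_mem ?_ ?_
    · simpa only [mem_homogeneousSubmodule, add_comm 1] using (isHomogeneous_linForm η).mul hp
    · simpa only [mem_homogeneousSubmodule, Nat.add_sub_cancel, add_comm 2, add_assoc] using
        ((isHomogeneous_sqNorm n).mul (isHomogeneous_dirDeriv hp η)).C_mul _

lemma raise_mem_solidHarmonics [NeZero n] (η : Fin n → ℝ) {k : ℕ} {p : MvPolynomial (Fin n) ℝ}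
    (hp : p ∈ solidHarmonics n k) : raise η k p ∈ solidHarmonics n (k + 1) := by
  obtain ⟨hom, harm⟩ := mem_solidHarmonics.1 hp
  refine mem_solidHarmonics.2 ⟨isHomogeneous_raise η hom, ?_⟩
  rcases k with _ | k
  · rw [eq_C_of_isHomogeneous_zero hom, raise_C, ← smul_eq_C_mul, map_smul, polyLaplacian_apply]
    simp [pderiv_linForm]
  · have hk : (2 * (k + 1 : ℕ) + n - 2 : ℝ) ≠ 0 := by
      have : (0 : ℝ) < n := by exact_mod_cast NeZero.pos n
      push_cast
      linarith [(Nat.cast_nonneg k : (0 : ℝ) ≤ k)]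
    have coeff_eq : (1 / (2 * (k + 1 : ℕ) + n - 2) * (2 * n + 4 * k) : ℝ) = 2 := by
      field_simp
      push_cast
      ring
    rw [raise, map_sub, polyLaplacian_linForm_mul, harm, ← smul_eq_C_mul, map_smul,
      polyLaplacian_sqNorm_mul (isHomogeneous_dirDeriv hom η), polyLaplacian_dirDeriv, harm,
      map_zero, smul_eq_C_mul, Nat.add_sub_cancel, mul_zero, mul_zero, zero_add, zero_add,
      ← mul_assoc, ← C_mul, coeff_eq, map_ofNat, sub_self]

/-- The harmonic component of `⟨η, x⟩ᵏ`. For a unit vector `η` it is the zonal harmonic of degree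
`k` with pole `η`, up to a constant. -/
def zonal (η : Fin n → ℝ) : ℕ → MvPolynomial (Fin n) ℝ
  | 0 => 1
  | k + 1 => raise η k (zonal η k)

lemma zonal_one (η : Fin n → ℝ) : zonal η 1 = linForm η := by
  simpa [zonal] using raise_C η 0 1

lemma zonal_mem_solidHarmonics [NeZero n] (η : Fin n → ℝ) (k : ℕ) :
    zonal η k ∈ solidHarmonics n k := by
  induction k with
  | zero => exact mem_solidHarmonics.2 ⟨isHomogeneous_one _ _, by simp [zonal, polyLaplacian_apply]⟩
  | succ k ih => exact raise_mem_solidHarmonics η ih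

lemma isHomogeneous_zonal (η : Fin n → ℝ) (k : ℕ) : (zonal η k).IsHomogeneous k := by
  induction k with
  | zero => exact isHomogeneous_one _ _
  | succ k ih => exact isHomogeneous_raise η ih

/-- The factor `b_k` in the identity `∂_η Z_{k+1} = (k + 1) b_k Z_k` for the zonal harmonics with
pole `η`. -/
def zonalRatio (n : ℕ) : ℕ → ℝ
  | 0 => 1
  | k + 1 => (k + n - 1) / (2 * k + n)

lemma zonalRatio_succ [NeZero n] (k : ℕ) : (k + 2) * zonalRatio n (k + 1) =
    1 + (1 - 2 / (2 * k + n)) * ((k + 1) * zonalRatio n k) := by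
  have hn : (0 : ℝ) < n := by exact_mod_cast NeZero.pos n
  rcases k with _ | k
  · simp only [zonalRatio]
    push_cast
    field_simp
    ring
  · simp only [zonalRatio]
    push_cast
    field_simp
    ring

lemma dirDeriv_raise {η : Fin n → ℝ} (hη : ∑ i, η i ^ 2 = 1) (k : ℕ)
    (p : MvPolynomial (Fin n) ℝ) :
    dirDeriv η (raise η k p) = p + linForm η * dirDeriv η p - C (1 / (2 * k + n - 2) : ℝ) *
      (2 * (linForm η * dirDeriv η p) + sqNorm n * dirDeriv η (dirDeriv η p)) := by
  rw [raise, map_sub, dirDeriv_C_mul, Derivation.leibniz, Derivation.leibniz,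
    dirDeriv_linForm hη, dirDeriv_sqNorm]
  simp only [smul_eq_mul]
  ring

theorem dirDeriv_zonal_succ [NeZero n] {η : Fin n → ℝ} (hη : ∑ i, η i ^ 2 = 1) (k : ℕ) :
    dirDeriv η (zonal η (k + 1)) = C ((k + 1) * zonalRatio n k) * zonal η k := by
  induction k with
  | zero =>
    rw [zero_add, zonal_one, dirDeriv_linForm hη]
    simp [zonal, zonalRatio]
  | succ k ih =>
    set Z := zonal η k
    set Z' := zonal η (k + 1)
    set S' := sqNorm n * dirDeriv η Z
    set a : ℝ := (k + 1) * zonalRatio n k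
    have linForm_mul : linForm η * Z = Z' + C (1 / (2 * k + n - 2) : ℝ) * S' :=
      (sub_add_cancel _ _).symm
    have cancel : C ((1 - 2 / (2 * k + n)) * (1 / (2 * k + n - 2)) : ℝ) * S' =
        C (1 / (2 * k + n) : ℝ) * S' := by
      rcases k with _ | k
      · simp [S', Z, zonal, Derivation.map_one_eq_zero]
      · have hn : (0 : ℝ) < n := by exact_mod_cast NeZero.pos n
        have h₀ : (2 * (k : ℝ) + n) ≠ 0 := by positivity
        have h₁ : (2 * ((k : ℝ) + 1) + n) ≠ 0 := by positivity
        have h₂ : (2 * ((k : ℝ) + 1) + n - 2) ≠ 0 := by convert h₀ using 1; ring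
        congr 2
        push_cast
        field_simp
    rw [zonal, dirDeriv_raise hη, ih, dirDeriv_C_mul,
      show (2 * (k + 1 : ℕ) + n - 2 : ℝ) = 2 * k + n by push_cast; ring,
      show (((k + 1 : ℕ) : ℝ) + 1) * zonalRatio n (k + 1) = 1 + (1 - 2 / (2 * k + n)) * a by
        rw [← zonalRatio_succ]; push_cast; ring]
    rw [show (2 / (2 * k + n) : ℝ) = 2 * (1 / (2 * k + n)) by ring] at cancel ⊢
    simp only [map_add, map_sub, map_mul, map_one, map_ofNat] at linForm_mul cancel ⊢
    linear_combination (C a * (1 - 2 * C (1 / (2 * k + n) : ℝ))) * linForm_mul + C a * cancel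

theorem zonal_succ_succ [NeZero n] {η : Fin n → ℝ} (hη : ∑ i, η i ^ 2 = 1) (k : ℕ) :
    zonal η (k + 2) = linForm η * zonal η (k + 1) -
      C ((k + 1) * zonalRatio n k / (2 * k + n)) * (sqNorm n * zonal η k) := by
  rw [zonal, raise, dirDeriv_zonal_succ hη,
    show (2 * (k + 1 : ℕ) + n - 2 : ℝ) = 2 * k + n by push_cast; ring]
  generalize (k + 1 : ℝ) * zonalRatio n k = a
  rw [div_eq_mul_one_div a, C_mul]
  ring

end HarmonicPolynomials

section GaussianIntegral

open MvPolynomial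

variable {n : ℕ}

lemma integrable_pow_mul_exp_neg_sq_half (j : ℕ) :
    Integrable fun x : ℝ => x ^ j * Real.exp (-x ^ 2 / 2) := by
  have h := integrable_rpow_mul_exp_neg_mul_sq (b := 1 / 2) (by norm_num) (s := j)
    (by linarith [(Nat.cast_nonneg j : (0 : ℝ) ≤ j)])
  refine h.congr (.of_forall fun x => ?_)
  simp only [Real.rpow_natCast]
  ring_nf

/-- The moments of the unnormalized Gaussian weight on the line. -/
def gaussMoment (j : ℕ) : ℝ := ∫ x : ℝ, x ^ j * Real.exp (-x ^ 2 / 2)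

lemma gaussMoment_zero_pos : 0 < gaussMoment 0 := by
  have : gaussMoment 0 = √(Real.pi / (1 / 2)) := by
    rw [← integral_gaussian (1 / 2), gaussMoment]
    congr with x
    ring_nf
  rw [this]
  positivity

lemma gaussMoment_succ (j : ℕ) : gaussMoment (j + 1) = j * gaussMoment (j - 1) := by
  have hasDerivAt_exp (x : ℝ) : HasDerivAt (fun x : ℝ => -Real.exp (-x ^ 2 / 2))
      (x * Real.exp (-x ^ 2 / 2)) x := by
    refine (((hasDerivAt_pow 2 x).fun_neg.div_const 2).exp).fun_neg.congr_deriv ?_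
    norm_num
    ring
  have byParts := integral_mul_deriv_eq_deriv_mul_of_integrable (u := fun x : ℝ => x ^ j)
    (fun x _ => hasDerivAt_pow j x) (fun x _ => hasDerivAt_exp x)
    ((integrable_pow_mul_exp_neg_sq_half (j + 1)).congr
      (.of_forall fun x => by simp only [Pi.mul_apply]; ring))
    (((integrable_pow_mul_exp_neg_sq_half (j - 1)).const_mul (-j)).congr
      (.of_forall fun x => by simp only [Pi.mul_apply]; ring))
    ((integrable_pow_mul_exp_neg_sq_half j).neg.congr
      (.of_forall fun x => by simp only [Pi.mul_apply, Pi.neg_apply]; ring))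
  calc gaussMoment (j + 1) = ∫ x : ℝ, x ^ j * (x * Real.exp (-x ^ 2 / 2)) := by
        simp only [gaussMoment, pow_succ, mul_assoc]
    _ = j * gaussMoment (j - 1) := by
        rw [byParts, gaussMoment, ← integral_const_mul, ← integral_neg]
        congr with x
        ring

lemma eval_monomial_mul_exp (s : Fin n →₀ ℕ) (a : ℝ) (x : Space n) :
    eval (fun i => x i) (monomial s a) * Real.exp (-‖x‖ ^ 2 / 2) =
      a * ∏ i, (x i ^ s i * Real.exp (-x i ^ 2 / 2)) := by
  rw [eval_monomial, Finsupp.prod_fintype _ _ (by simp), Finset.prod_mul_distrib, ← Real.exp_sum,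
    EuclideanSpace.real_norm_sq_eq, ← Finset.sum_div, Finset.sum_neg_distrib, mul_assoc]

lemma integrable_eval_mul_exp (p : MvPolynomial (Fin n) ℝ) :
    Integrable fun x : Space n => eval (fun i => x i) p * Real.exp (-‖x‖ ^ 2 / 2) := by
  induction p using MvPolynomial.induction_on' with
  | monomial s a =>
    simp_rw [eval_monomial_mul_exp]
    exact (((PiLp.volume_preserving_ofLp (Fin n)).integrable_comp_emb
      (MeasurableEquiv.toLp 2 (Fin n → ℝ)).symm.measurableEmbedding).2
      (Integrable.fintype_prod fun i => integrable_pow_mul_exp_neg_sq_half (s i))).const_mul a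
  | add p q hp hq =>
    simp only [map_add, add_mul]
    exact hp.add hq

/-- Integration of polynomials against the unnormalized Gaussian weight. -/
def gaussInt : MvPolynomial (Fin n) ℝ →ₗ[ℝ] ℝ where
  toFun p := ∫ x : Space n, eval (fun i => x i) p * Real.exp (-‖x‖ ^ 2 / 2)
  map_add' p q := by
    simp only [map_add, add_mul]
    exact integral_add (integrable_eval_mul_exp p) (integrable_eval_mul_exp q)
  map_smul' a p := by
    simp only [smul_eval, mul_assoc, integral_const_mul, RingHom.id_apply, smul_eq_mul]

lemma gaussInt_C_mul (a : ℝ) (p : MvPolynomial (Fin n) ℝ) :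
    gaussInt (C a * p) = a * gaussInt p := by
  rw [← smul_eq_C_mul, map_smul, smul_eq_mul]

lemma gaussInt_monomial (s : Fin n →₀ ℕ) (a : ℝ) :
    gaussInt (monomial s a) = a * ∏ i, gaussMoment (s i) := by
  simp only [gaussInt, LinearMap.coe_mk, AddHom.coe_mk, eval_monomial_mul_exp, gaussMoment,
    integral_const_mul]
  rw [← integral_fintype_prod_volume_eq_prod fun i (x : ℝ) => x ^ s i * Real.exp (-x ^ 2 / 2),
    ← (PiLp.volume_preserving_ofLp (Fin n)).integral_comp
      (MeasurableEquiv.toLp 2 (Fin n → ℝ)).symm.measurableEmbedding]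

lemma gaussInt_one_pos : 0 < gaussInt (1 : MvPolynomial (Fin n) ℝ) := by
  rw [← C_1, C_apply, gaussInt_monomial, one_mul]
  exact Finset.prod_pos fun _ _ => gaussMoment_zero_pos

lemma gaussInt_X_mul (i : Fin n) (p : MvPolynomial (Fin n) ℝ) :
    gaussInt (X i * p) = gaussInt (pderiv i p) := by
  induction p using MvPolynomial.induction_on' with
  | monomial s a =>
    rw [pderiv_monomial, X, monomial_mul, gaussInt_monomial, gaussInt_monomial, one_mul, mul_assoc,
      ← Finset.mul_prod_erase Finset.univ _ (Finset.mem_univ i),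
      ← Finset.mul_prod_erase Finset.univ _ (Finset.mem_univ i), ← mul_assoc (s i : ℝ)]
    congr 2
    · simp [add_comm 1, gaussMoment_succ]
    · refine Finset.prod_congr rfl fun j hj => ?_
      simp [(Finset.ne_of_mem_erase hj).symm]
  | add p q hp hq => rw [mul_add, map_add, map_add, map_add, hp, hq]

lemma gaussInt_linForm_mul (η : Fin n → ℝ) (p : MvPolynomial (Fin n) ℝ) :
    gaussInt (linForm η * p) = gaussInt (dirDeriv η p) := by
  simp only [linForm, Finset.sum_mul, dirDeriv_apply, map_sum, mul_assoc, gaussInt_C_mul,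
    gaussInt_X_mul]

lemma gaussInt_sqNorm_mul {p : MvPolynomial (Fin n) ℝ} {m : ℕ} (hp : p.IsHomogeneous m) :
    gaussInt (sqNorm n * p) = (n + m) * gaussInt p := by
  have byParts (i : Fin n) :
      gaussInt (X i * X i * p) = gaussInt p + gaussInt (X i * pderiv i p) := by
    rw [mul_assoc, gaussInt_X_mul, pderiv_mul, pderiv_X_self, one_mul, map_add]
  simp only [sqNorm, Finset.sum_mul, map_sum, byParts, Finset.sum_add_distrib, Finset.sum_const,
    Finset.card_univ, Fintype.card_fin, nsmul_eq_mul]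
  rw [← map_sum, hp.sum_X_mul_pderiv, map_nsmul, nsmul_eq_mul, add_mul]

lemma gaussInt_sqNorm_pow (k : ℕ) : gaussInt (sqNorm n ^ k) =
    gaussInt (1 : MvPolynomial (Fin n) ℝ) * ∏ j ∈ Finset.range k, (n + 2 * j : ℝ) := by
  induction k with
  | zero => simp
  | succ k ih =>
    rw [pow_succ', gaussInt_sqNorm_mul ((isHomogeneous_sqNorm n).pow k), ih,
      Finset.prod_range_succ]
    push_cast
    ring

lemma natCast_mul_gaussInt_mul (p : MvPolynomial (Fin n) ℝ) {q : MvPolynomial (Fin n) ℝ} {k : ℕ}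
    (hq : q ∈ solidHarmonics n k) :
    k * gaussInt (p * q) = ∑ i, gaussInt (pderiv i p * pderiv i q) := by
  obtain ⟨hom, harm⟩ := mem_solidHarmonics.1 hq
  have byParts (i : Fin n) : gaussInt (p * (X i * pderiv i q)) =
      gaussInt (pderiv i p * pderiv i q) + gaussInt (p * pderiv i (pderiv i q)) := by
    rw [mul_left_comm, gaussInt_X_mul, pderiv_mul, map_add]
  calc k * gaussInt (p * q) = gaussInt (p * ∑ i, X i * pderiv i q) := by
        rw [hom.sum_X_mul_pderiv, mul_smul_comm, map_nsmul, nsmul_eq_mul]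
    _ = ∑ i, gaussInt (pderiv i p * pderiv i q) + gaussInt (p * polyLaplacian n q) := by
        simp only [polyLaplacian_apply, Finset.mul_sum, map_sum, byParts, Finset.sum_add_distrib]
    _ = ∑ i, gaussInt (pderiv i p * pderiv i q) := by rw [harm, mul_zero, map_zero, add_zero]

theorem gaussInt_mul_eq_zero {p q : MvPolynomial (Fin n) ℝ} {m k : ℕ} (hp : p.IsHomogeneous m)
    (hq : q ∈ solidHarmonics n k) (hmk : m < k) : gaussInt (p * q) = 0 := by
  induction m generalizing p q k with
  | zero =>
    refine (mul_eq_zero_iff_left (Nat.cast_ne_zero.2 hmk.ne')).1 ?_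
    rw [natCast_mul_gaussInt_mul p hq, eq_C_of_isHomogeneous_zero hp]
    simp only [pderiv_C, zero_mul, map_zero, Finset.sum_const_zero]
  | succ m ih =>
    refine (mul_eq_zero_iff_left (Nat.cast_ne_zero.2 (Nat.ne_zero_of_lt hmk))).1 ?_
    rw [natCast_mul_gaussInt_mul p hq]
    exact Finset.sum_eq_zero fun i _ => ih (by simpa using hp.pderiv (i := i))
      (pderiv_mem_solidHarmonics hq i) (by omega)

theorem gaussInt_raise_mul (η : Fin n → ℝ) {p q : MvPolynomial (Fin n) ℝ} {k : ℕ}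
    (hp : p.IsHomogeneous k) (hq : q ∈ solidHarmonics n (k + 1)) :
    gaussInt (raise η k p * q) = gaussInt (p * dirDeriv η q) := by
  have hp' := isHomogeneous_dirDeriv hp η
  have orthogonal : gaussInt (dirDeriv η p * q) = 0 := gaussInt_mul_eq_zero hp' hq (by omega)
  rw [raise, sub_mul, map_sub, mul_assoc, mul_assoc, mul_assoc, gaussInt_linForm_mul,
    gaussInt_C_mul, gaussInt_sqNorm_mul (hp'.mul (mem_solidHarmonics.1 hq).1), orthogonal,
    Derivation.leibniz, map_add, smul_eq_mul, smul_eq_mul, mul_comm q, orthogonal, mul_zero,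
    mul_zero, sub_zero, add_zero]

theorem gaussInt_zonal_mul (η : Fin n → ℝ) (k : ℕ)
    {q : MvPolynomial (Fin n) ℝ} (hq : q ∈ solidHarmonics n k) :
    gaussInt (zonal η k * q) = gaussInt (1 : MvPolynomial (Fin n) ℝ) * k.factorial * eval η q := by
  induction k generalizing q with
  | zero =>
    rw [eq_C_of_isHomogeneous_zero (mem_solidHarmonics.1 hq).1, zonal, mul_comm, gaussInt_C_mul,
      eval_C, Nat.factorial_zero, Nat.cast_one, mul_one, mul_comm]
  | succ k ih =>
    rw [zonal, gaussInt_raise_mul η (isHomogeneous_zonal η k) hq,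
      ih (by simpa using dirDeriv_mem_solidHarmonics hq η),
      eval_dirDeriv_self (mem_solidHarmonics.1 hq).1, Nat.factorial_succ]
    push_cast
    ring

end GaussianIntegral

section SphereIntegral

open MvPolynomial

lemma integral_mul_norm_of_homogeneous {E : Type*} [NormedAddCommGroup E] [NormedSpace ℝ E]
    [FiniteDimensional ℝ E] [MeasurableSpace E] [BorelSpace E] (μ : Measure E)
    [μ.IsAddHaarMeasure] [Nontrivial E] {f : E → ℝ} {m : ℕ}
    (hf : ∀ (r : ℝ) (x : E), f (r • x) = r ^ m * f x) (g : ℝ → ℝ) :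
    ∫ x, f x * g ‖x‖ ∂μ = (∫ θ : Metric.sphere (0 : E) 1, f θ ∂μ.toSphere) *
      ∫ r : Set.Ioi (0 : ℝ), (r : ℝ) ^ m * g r ∂(.volumeIoiPow (Module.finrank ℝ E - 1)) := by
  calc ∫ x, f x * g ‖x‖ ∂μ = ∫ x : ({0}ᶜ : Set E), f x * g ‖(x : E)‖ ∂(μ.comap (↑)) := by
        rw [integral_subtype_comap (measurableSet_singleton _).compl (fun x => f x * g ‖x‖),
          restrict_compl_singleton]
    _ = ∫ q : Metric.sphere (0 : E) 1 × Set.Ioi (0 : ℝ), f q.1 * ((q.2 : ℝ) ^ m * g q.2)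
          ∂(μ.toSphere.prod (.volumeIoiPow (Module.finrank ℝ E - 1))) := by
        rw [← μ.measurePreserving_homeomorphUnitSphereProd.integral_comp
          (Homeomorph.measurableEmbedding _)]
        refine integral_congr_ae (.of_forall fun x => ?_)
        have polar : f x = ‖(x : E)‖ ^ m * f (‖(x : E)‖⁻¹ • x) := by
          rw [← hf, smul_inv_smul₀ (norm_ne_zero_iff.2 x.2)]
        simp only [homeomorphUnitSphereProd_apply_snd_coe, homeomorphUnitSphereProd_apply_fst_coe,
          polar]
        ring
    _ = _ := integral_prod_mul (fun θ : Metric.sphere (0 : E) 1 => f θ)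
        fun r : Set.Ioi (0 : ℝ) => (r : ℝ) ^ m * g r

variable {n : ℕ} [NeZero n]

instance : Nontrivial (Space n) :=
  Module.nontrivial_of_finrank_pos (R := ℝ) (by rw [finrank_euclideanSpace_fin]; exact NeZero.pos n)

instance : IsProbabilityMeasure (sphereMeasure n) where
  measure_univ := by
    rw [sphereMeasure, Measure.smul_apply, smul_eq_mul, ENNReal.inv_mul_cancel
      (Measure.measure_univ_ne_zero.2 (Measure.toSphere_ne_zero _)) (measure_ne_top _ _)]

lemma eval_smul_of_isHomogeneous {σ R : Type*} [CommSemiring R] {p : MvPolynomial σ R} {k : ℕ}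
    (hp : p.IsHomogeneous k) (r : R) (x : σ → R) : eval (r • x) p = r ^ k * eval x p := by
  rw [eval_eq, eval_eq, Finset.mul_sum]
  refine Finset.sum_congr rfl fun d hd => ?_
  have degree : ∑ i ∈ d.support, d i = k := by
    rw [← Finsupp.degree_apply, Finsupp.degree_eq_weight_one]
    exact hp (mem_support_iff.1 hd)
  simp only [Pi.smul_apply, smul_eq_mul, mul_pow, Finset.prod_mul_distrib,
    Finset.prod_pow_eq_pow_sum, degree]
  ring

lemma exists_gaussInt_eq_sphere (n : ℕ) [NeZero n] (m : ℕ) :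
    ∃ c : ℝ, ∀ p : MvPolynomial (Fin n) ℝ, p.IsHomogeneous m →
      gaussInt p = c * ∫ θ : Sphere n, eval (fun i => (θ : Space n) i) p ∂(sphereMeasure n) := by
  have area_ne_zero : (volume : Measure (Space n)).toSphere.real Set.univ ≠ 0 :=
    (measureReal_ne_zero_iff (measure_ne_top _ _)).2
      (Measure.measure_univ_ne_zero.2 (Measure.toSphere_ne_zero _))
  refine ⟨(volume : Measure (Space n)).toSphere.real Set.univ *
    ∫ r : Set.Ioi (0 : ℝ), (r : ℝ) ^ m * Real.exp (-(r : ℝ) ^ 2 / 2)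
      ∂(.volumeIoiPow (Module.finrank ℝ (Space n) - 1)), fun p hp => ?_⟩
  refine (integral_mul_norm_of_homogeneous volume (m := m)
    (fun r x => eval_smul_of_isHomogeneous hp r (fun i => x i))
    (fun r => Real.exp (-r ^ 2 / 2))).trans ?_
  rw [sphereMeasure, integral_smul_measure, ENNReal.toReal_inv, smul_eq_mul, ← Measure.real]
  field_simp

omit [NeZero n] in
lemma eval_sqNorm (x : Space n) : eval (fun i => x i) (sqNorm n) = ‖x‖ ^ 2 := by
  rw [EuclideanSpace.real_norm_sq_eq]
  simp [sqNorm, sq]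

/-- The constants which turn the zonal polynomials into reproducing kernels on the sphere. -/
def zonalConst (n k : ℕ) : ℝ := ∏ j ∈ Finset.range k, (n + 2 * j : ℝ) / (j + 1)

theorem integral_zonal_mul (η : Fin n → ℝ) (k : ℕ) {q : MvPolynomial (Fin n) ℝ}
    (hq : q ∈ solidHarmonics n k) :
    zonalConst n k * ∫ θ : Sphere n, eval (fun i => (θ : Space n) i) (zonal η k * q)
      ∂(sphereMeasure n) = eval η q := by
  obtain ⟨c, hc⟩ := exists_gaussInt_eq_sphere n (2 * k)
  have norm_pow := hc (sqNorm n ^ k) ((isHomogeneous_sqNorm n).pow k)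
  simp only [map_pow, eval_sqNorm, norm_eq_of_mem_sphere, one_pow, integral_const, probReal_univ,
    smul_eq_mul, mul_one, gaussInt_sqNorm_pow] at norm_pow
  have reproducing := hc (zonal η k * q)
    (by simpa [two_mul] using (isHomogeneous_zonal η k).mul (mem_solidHarmonics.1 hq).1)
  rw [gaussInt_zonal_mul η k hq, ← norm_pow] at reproducing
  have factorial_pos : (0 : ℝ) < k.factorial := by positivity
  rw [zonalConst, Finset.prod_div_distrib, show ∏ j ∈ Finset.range k, ((j : ℝ) + 1) = k.factorial by
    rw [← Finset.prod_range_add_one_eq_factorial]; push_cast; rfl,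
    div_mul_eq_mul_div, div_eq_iff factorial_pos.ne']
  refine mul_left_cancel₀ (gaussInt_one_pos (n := n)).ne' ?_
  linear_combination -reproducing

end SphereIntegral

section ZonalHarmonics

open MvPolynomial

variable {n : ℕ}

/-- The Gegenbauer polynomials `C_k^(lam)(t)`, by their three-term recurrence. -/
def gegenbauer (lam t : ℝ) : ℕ → ℝ
  | 0 => 1
  | 1 => 2 * lam * t
  | k + 2 => (2 * (k + 1 + lam) * t * gegenbauer lam t (k + 1) -
      (k + 2 * lam) * gegenbauer lam t k) / (k + 2)

lemma gegenbauer_succ_succ (lam t : ℝ) (k : ℕ) : (k + 2) * gegenbauer lam t (k + 2) =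
    2 * (k + 1 + lam) * t * gegenbauer lam t (k + 1) - (k + 2 * lam) * gegenbauer lam t k := by
  rw [gegenbauer]
  field_simp

/-- The reproducing kernel of the spherical harmonics of degree `k` on the sphere of `ℝⁿ`, as a
function of the inner product `t` of its two arguments. -/
def zonalValue (n : ℕ) (t : ℝ) : ℕ → ℝ
  | 0 => 1
  | 1 => n * t
  | k + 2 => gegenbauer (n / 2) t (k + 2) - gegenbauer (n / 2) t k

lemma zonalValue_add_two_eq_gegenbauer (n : ℕ) (t : ℝ) (k : ℕ) :
    (k + 2) * zonalValue n t (k + 2) =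
      (2 * k + n + 2) * (t * gegenbauer (n / 2) t (k + 1) - gegenbauer (n / 2) t k) := by
  rw [zonalValue, mul_sub, gegenbauer_succ_succ]
  ring

lemma zonalValue_succ_succ [NeZero n] (t : ℝ) (k : ℕ) :
    (k + 2) * zonalValue n t (k + 2) =
      (2 * k + n + 2) * (t * zonalValue n t (k + 1) - zonalRatio n k * zonalValue n t k) := by
  have hn : (0 : ℝ) < n := by exact_mod_cast NeZero.pos n
  rw [zonalValue_add_two_eq_gegenbauer]
  congr 1
  rcases k with _ | _ | k
  · simp only [zonalValue, gegenbauer, zonalRatio]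
    ring
  · simp only [zonalValue, gegenbauer, zonalRatio]
    push_cast
    field_simp
    ring
  · have recurrence := gegenbauer_succ_succ (n / 2) t k
    have denom_pos : 0 < 2 * ((k : ℝ) + 1) + n := by positivity
    have ratio : zonalRatio n (k + 2) * (2 * ((k : ℝ) + 1) + n) = k + n := by
      simp only [zonalRatio]
      push_cast
      field_simp
      ring
    simp only [zonalValue]
    refine mul_left_cancel₀ denom_pos.ne' ?_
    linear_combination (-1 : ℝ) * recurrence +
      (gegenbauer (n / 2) t (k + 2) - gegenbauer (n / 2) t k) * ratio

lemma sum_sq_sphere (η : Sphere n) : ∑ i, (η : Space n) i ^ 2 = 1 := by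
  rw [← EuclideanSpace.real_norm_sq_eq, norm_eq_of_mem_sphere, one_pow]

lemma eval_linForm (η x : Space n) :
    eval (fun i => x i) (linForm fun i => η i) = inner ℝ η x := by
  simp [linForm, PiLp.inner_apply, mul_comm]

lemma zonalConst_succ (n k : ℕ) :
    zonalConst n (k + 1) = zonalConst n k * ((n + 2 * k) / (k + 1)) :=
  Finset.prod_range_succ _ _

variable [NeZero n]

lemma zonalConst_mul_eval_zonal (η θ : Sphere n) (k : ℕ) :
    zonalConst n k * eval (fun i => (θ : Space n) i) (zonal (fun i => (η : Space n) i) k) =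
      zonalValue n (inner ℝ (η : Space n) (θ : Space n)) k := by
  have hn : (0 : ℝ) < n := by exact_mod_cast NeZero.pos n
  induction k using Nat.twoStepInduction with
  | zero => simp [zonal, zonalConst, zonalValue]
  | one => simp [zonal_one, zonalConst, zonalValue, eval_linForm]
  | more k ih ih' =>
    refine mul_left_cancel₀ (by positivity : (k + 2 : ℝ) ≠ 0) ?_
    rw [zonalValue_succ_succ, ← ih, ← ih', zonal_succ_succ (sum_sq_sphere η), map_sub, map_mul,
      map_mul, map_mul, eval_C, eval_linForm, eval_sqNorm, norm_eq_of_mem_sphere,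
      zonalConst_succ n (k + 1), zonalConst_succ n k]
    push_cast
    field_simp
    ring

lemma integrable_eval_sphere (p : MvPolynomial (Fin n) ℝ) :
    Integrable (fun θ : Sphere n => eval (fun i => (θ : Space n) i) p) (sphereMeasure n) :=
  Continuous.integrable_of_hasCompactSupport (p.continuous_eval.comp (by fun_prop))
    (.of_compactSpace _)

theorem sum_val_mul_val (Y : HarmonicBasis n) (k : ℕ) (η x : Space n) :
    ∑ l, Y.val ⟨k, l⟩ η * Y.val ⟨k, l⟩ x =
      zonalConst n k * eval (fun i => x i) (zonal (fun i => η i) k) := by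
  set z : solidHarmonics n k := ⟨zonal (fun i => η i) k, zonal_mem_solidHarmonics _ k⟩
  have zonal_eq : zonal (fun i => η i) k =
      ∑ l, (Y.basis k).repr z l • (Y.basis k l : MvPolynomial (Fin n) ℝ) := by
    simpa only [z, AddSubmonoidClass.coe_finsetSum, SetLike.val_smul] using
      (congrArg Subtype.val ((Y.basis k).sum_repr z)).symm
  have repr_eq (l) : zonalConst n k * (Y.basis k).repr z l = Y.val ⟨k, l⟩ η := by
    rw [HarmonicBasis.val, ← integral_zonal_mul _ k (Y.basis k l).2, zonal_eq]
    have orthonormal (m) := Y.orthonormal ⟨k, m⟩ ⟨k, l⟩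
    simp only [Sigma.mk.injEq, true_and, heq_eq_eq] at orthonormal
    simp only [Finset.sum_mul, map_sum, smul_mul_assoc, smul_eval, map_mul]
    rw [integral_finsetSum _ fun m _ => ?_]
    · simp only [integral_const_mul, orthonormal, mul_ite, mul_one, mul_zero,
        Finset.sum_ite_eq', Finset.mem_univ, if_true]
    · simpa only [← map_mul] using (integrable_eval_sphere _).const_mul _
  simp only [zonal_eq, map_sum, smul_eval, Finset.mul_sum, ← mul_assoc, repr_eq]
  rfl

theorem sum_val_mul_val_sphere (Y : HarmonicBasis n) (k : ℕ) (η θ : Sphere n) :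
    ∑ l, Y.val ⟨k, l⟩ (η : Space n) * Y.val ⟨k, l⟩ (θ : Space n) =
      zonalValue n (inner ℝ (η : Space n) (θ : Space n)) k := by
  rw [sum_val_mul_val, zonalConst_mul_eval_zonal]

end ZonalHarmonics

section GeneratingFunction

/-- The Taylor coefficients of a function at the origin. -/
def taylorCoeff (f : ℂ → ℂ) (k : ℕ) : ℂ := iteratedDeriv k f 0 / k.factorial

lemma taylorCoeff_congr {f g : ℂ → ℂ} (h : f =ᶠ[𝓝 0] g) (k : ℕ) :
    taylorCoeff f k = taylorCoeff g k := by
  rw [taylorCoeff, h.iteratedDeriv_eq, taylorCoeff]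

lemma taylorCoeff_add {f g : ℂ → ℂ} (hf : AnalyticAt ℂ f 0) (hg : AnalyticAt ℂ g 0) (k : ℕ) :
    taylorCoeff (fun w => f w + g w) k = taylorCoeff f k + taylorCoeff g k := by
  rw [taylorCoeff, iteratedDeriv_fun_add hf.contDiffAt hg.contDiffAt, add_div]
  rfl

lemma taylorCoeff_const_mul (c : ℂ) (f : ℂ → ℂ) (k : ℕ) :
    taylorCoeff (fun w => c * f w) k = c * taylorCoeff f k := by
  rw [taylorCoeff, iteratedDeriv_const_mul_field, mul_div_assoc]
  rfl

lemma taylorCoeff_deriv (f : ℂ → ℂ) (k : ℕ) :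
    taylorCoeff (deriv f) k = (k + 1) * taylorCoeff f (k + 1) := by
  have : (k + 1 : ℂ) ≠ 0 := k.cast_add_one_ne_zero
  rw [taylorCoeff, taylorCoeff, iteratedDeriv_succ', Nat.factorial_succ]
  push_cast
  field_simp

lemma taylorCoeff_id_mul_zero (f : ℂ → ℂ) : taylorCoeff (fun w => w * f w) 0 = 0 := by
  simp [taylorCoeff]

lemma taylorCoeff_id_mul_succ {f : ℂ → ℂ} (hf : AnalyticAt ℂ f 0) (k : ℕ) :
    taylorCoeff (fun w => w * f w) (k + 1) = taylorCoeff f k := by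
  have leibniz := iteratedDeriv_fun_mul (n := k + 1) (x := (0 : ℂ)) (f := fun w => w) (g := f)
    contDiffAt_id hf.contDiffAt
  rw [taylorCoeff, taylorCoeff, leibniz, Finset.sum_eq_single 1 ?_ (by simp)]
  · have : (k + 1 : ℂ) ≠ 0 := k.cast_add_one_ne_zero
    simp only [Nat.choose_one_right, iteratedDeriv_one, deriv_id'', Nat.factorial_succ,
      add_tsub_cancel_right]
    push_cast
    field_simp
  · rintro (_ | _ | j) - hj
    · simp
    · exact absurd rfl hj
    · simp [iteratedDeriv_succ', iteratedDeriv_const]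

lemma taylorCoeff_id_mul_deriv {f : ℂ → ℂ} (hf : AnalyticAt ℂ f 0) (k : ℕ) :
    taylorCoeff (fun w => w * deriv f w) k = k * taylorCoeff f k := by
  rcases k with _ | k
  · simp [taylorCoeff_id_mul_zero]
  · rw [taylorCoeff_id_mul_succ hf.deriv, taylorCoeff_deriv]
    push_cast
    rfl

lemma one_sub_mem_slitPlane {t : ℝ} (ht : |t| ≤ 1) {w : ℂ} (hw : ‖w‖ < 1) :
    1 - 2 * t * w + w ^ 2 ∈ Complex.slitPlane := by
  have norm_lt : w.re ^ 2 + w.im ^ 2 < 1 := by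
    rw [← one_pow 2, sq w.re, sq w.im, ← Complex.normSq_apply, ← Complex.sq_norm]
    gcongr
  have sq_le : t ^ 2 ≤ 1 := (sq_le_one_iff_abs_le_one t).2 ht
  rw [Complex.mem_slitPlane_iff]
  by_contra! h
  simp only [sq, Complex.add_re, Complex.sub_re, Complex.one_re, Complex.mul_re, Complex.re_ofNat,
    Complex.ofReal_re, Complex.im_ofNat, Complex.ofReal_im, Complex.mul_im, Complex.add_im,
    Complex.sub_im, Complex.one_im] at h
  obtain ⟨re_nonpos, im_eq_zero⟩ := h
  rcases mul_eq_zero.1 (by linarith : w.im * (w.re - t) = 0) with h | h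
  · rw [h] at re_nonpos norm_lt
    nlinarith [sq_nonneg (w.re - t)]
  · rw [sub_eq_zero.1 h] at re_nonpos norm_lt
    nlinarith

/-- The generating function of the Gegenbauer polynomials `C_k^(lam)(t)`. -/
def gegenbauerGen (lam t : ℝ) (w : ℂ) : ℂ := (1 - 2 * t * w + w ^ 2) ^ (-lam : ℂ)

lemma hasDerivAt_gegenbauerGen (lam : ℝ) {t : ℝ} (ht : |t| ≤ 1) {w : ℂ} (hw : ‖w‖ < 1) :
    HasDerivAt (gegenbauerGen lam t)
      (2 * lam * (t - w) * gegenbauerGen lam t w / (1 - 2 * t * w + w ^ 2)) w := by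
  have mem_slitPlane := one_sub_mem_slitPlane ht hw
  have hasDerivAt_base : HasDerivAt (fun w : ℂ => 1 - 2 * t * w + w ^ 2) (-(2 * t) + 2 * w) w := by
    refine ((((hasDerivAt_id w).const_mul (2 * t : ℂ)).const_sub 1).add
      ((hasDerivAt_id w).pow 2)).congr_deriv ?_
    simp
  refine (hasDerivAt_base.cpow_const mem_slitPlane).congr_deriv ?_
  rw [Complex.cpow_sub _ _ (Complex.slitPlane_ne_zero mem_slitPlane), Complex.cpow_one,
    gegenbauerGen]
  ring

lemma differentiableOn_gegenbauerGen (lam : ℝ) {t : ℝ} (ht : |t| ≤ 1) :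
    DifferentiableOn ℂ (gegenbauerGen lam t) (Metric.ball 0 1) := fun _ hz =>
  (hasDerivAt_gegenbauerGen lam ht
    (mem_ball_zero_iff.1 hz)).differentiableAt.differentiableWithinAt

lemma taylorCoeff_gegenbauerGen_succ (lam : ℝ) {t : ℝ} (ht : |t| ≤ 1) (k : ℕ) :
    (k + 1) * taylorCoeff (gegenbauerGen lam t) (k + 1) =
      2 * (k + lam) * t * taylorCoeff (gegenbauerGen lam t) k -
        taylorCoeff (fun w => w * (w * deriv (gegenbauerGen lam t) w)) k -
        2 * lam * taylorCoeff (fun w => w * gegenbauerGen lam t w) k := by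
  set f := gegenbauerGen lam t
  have hf : AnalyticAt ℂ f 0 := (differentiableOn_gegenbauerGen lam ht).analyticAt
    (Metric.ball_mem_nhds 0 one_pos)
  have : AnalyticAt ℂ (deriv f) 0 := hf.deriv
  have differentialEquation : deriv f =ᶠ[𝓝 0] fun w =>
      (2 * t * (w * deriv f w) + 2 * lam * t * f w) +
        (-1 * (w * (w * deriv f w)) + (-(2 * lam)) * (w * f w)) := by
    filter_upwards [Metric.ball_mem_nhds (0 : ℂ) one_pos] with w hw
    rw [mem_ball_zero_iff] at hw
    have deriv_eq := (hasDerivAt_gegenbauerGen lam ht hw).deriv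
    rw [eq_div_iff (Complex.slitPlane_ne_zero (one_sub_mem_slitPlane ht hw))] at deriv_eq
    linear_combination deriv_eq
  rw [← taylorCoeff_deriv, taylorCoeff_congr differentialEquation,
    taylorCoeff_add (by fun_prop) (by fun_prop), taylorCoeff_add (by fun_prop) (by fun_prop),
    taylorCoeff_add (by fun_prop) (by fun_prop)]
  simp only [taylorCoeff_const_mul]
  rw [taylorCoeff_id_mul_deriv hf]
  ring

lemma taylorCoeff_gegenbauerGen (lam : ℝ) {t : ℝ} (ht : |t| ≤ 1) (k : ℕ) :
    taylorCoeff (gegenbauerGen lam t) k = gegenbauer lam t k := by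
  have hf : AnalyticAt ℂ (gegenbauerGen lam t) 0 :=
    (differentiableOn_gegenbauerGen lam ht).analyticAt (Metric.ball_mem_nhds 0 one_pos)
  have zeroth : taylorCoeff (gegenbauerGen lam t) 0 = 1 := by simp [taylorCoeff, gegenbauerGen]
  induction k using Nat.twoStepInduction with
  | zero => simp [zeroth, gegenbauer]
  | one => simpa [taylorCoeff_id_mul_zero, zeroth, gegenbauer] using
      taylorCoeff_gegenbauerGen_succ lam ht 0
  | more k ih ih' =>
    have recurrence := taylorCoeff_gegenbauerGen_succ lam ht (k + 1)
    have gegenbauer_rec := congrArg (fun x : ℝ => (x : ℂ)) (gegenbauer_succ_succ lam t k)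
    rw [taylorCoeff_id_mul_succ (by fun_prop), taylorCoeff_id_mul_succ hf,
      taylorCoeff_id_mul_deriv hf, ih, ih'] at recurrence
    have : (k + 2 : ℂ) ≠ 0 := by exact_mod_cast (k + 1).succ_ne_zero
    refine mul_left_cancel₀ this ?_
    push_cast at recurrence gegenbauer_rec
    rw [gegenbauer_rec]
    linear_combination recurrence

theorem hasSum_gegenbauer (lam : ℝ) {t : ℝ} (ht : |t| ≤ 1) {w : ℂ} (hw : ‖w‖ < 1) :
    HasSum (fun k => (gegenbauer lam t k : ℂ) * w ^ k) (gegenbauerGen lam t w) := by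
  refine (Complex.hasSum_taylorSeries_on_ball (r := 1)
    (by simpa using differentiableOn_gegenbauerGen lam ht) (z := w) (by simpa using hw)).congr_fun
    fun k => ?_
  rw [← taylorCoeff_gegenbauerGen lam ht, taylorCoeff, sub_zero, smul_eq_mul, smul_eq_mul]
  ring

theorem hasSum_zonalValue (n : ℕ) {t : ℝ} (ht : |t| ≤ 1) {w : ℂ} (hw : ‖w‖ < 1) :
    HasSum (fun k => (zonalValue n t k : ℂ) * w ^ k)
      ((1 - w ^ 2) * gegenbauerGen (n / 2) t w) := by
  have generating := hasSum_gegenbauer (n / 2) ht hw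
  have shifted : HasSum
      (fun k => if k < 2 then 0 else (gegenbauer (n / 2) t (k - 2) : ℂ) * w ^ k)
      (w ^ 2 * gegenbauerGen (n / 2) t w) := by
    rw [← hasSum_nat_add_iff' 2, Finset.sum_eq_zero fun i hi => if_pos (Finset.mem_range.1 hi),
      sub_zero]
    refine (generating.mul_left (w ^ 2)).congr_fun fun k => ?_
    rw [if_neg (by omega), Nat.add_sub_cancel]
    ring
  rw [sub_mul, one_mul]
  refine (generating.sub shifted).congr_fun fun k => ?_
  rcases k with _ | _ | k
  · simp [zonalValue, gegenbauer]
  · simp [zonalValue, gegenbauer, mul_div_cancel₀]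
  · simp [zonalValue, sub_mul]

lemma summable_zonalValue_one (n : ℕ) {ρ : ℝ} (hρ : 0 ≤ ρ) (hρ' : ρ < 1) :
    Summable fun k => zonalValue n 1 k * ρ ^ k := by
  exact_mod_cast (hasSum_zonalValue n (t := 1) (by simp) (w := ρ)
    (by simpa [abs_of_nonneg hρ])).summable

lemma summable_sq_mul_pow {a : ℕ → ℝ}
    (ha : ∀ ρ : ℝ, 0 ≤ ρ → ρ < 1 → Summable fun k => a k * ρ ^ k) {ρ : ℝ} (hρ : 0 ≤ ρ)
    (hρ' : ρ < 1) : Summable fun k => a k ^ 2 * ρ ^ k := by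
  have sqrt_lt {x : ℝ} (hx : x < 1) : √x < 1 := by rwa [Real.sqrt_lt' one_pos, one_pow]
  set σ := √√ρ
  have σ_sq : σ ^ 2 = √ρ := Real.sq_sqrt (Real.sqrt_nonneg ρ)
  obtain ⟨B, hB⟩ := (ha σ (Real.sqrt_nonneg _)
    (sqrt_lt (sqrt_lt hρ'))).tendsto_atTop_zero.norm.bddAbove_range
  refine Summable.of_nonneg_of_le (fun k => by positivity) (fun k => ?_)
    ((summable_geometric_of_lt_one (r := σ ^ 2) (by positivity) (σ_sq ▸ sqrt_lt hρ')).mul_left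
      (B ^ 2))
  have abs_le_B : |a k * σ ^ k| ≤ B := hB ⟨k, rfl⟩
  calc a k ^ 2 * ρ ^ k = (a k * σ ^ k) ^ 2 * (σ ^ 2) ^ k := by
        rw [← Real.sq_sqrt hρ, ← σ_sq]
        ring
    _ ≤ B ^ 2 * (σ ^ 2) ^ k := by
        gcongr ?_ * _
        exact sq_le_sq' (abs_le.1 abs_le_B).1 (abs_le.1 abs_le_B).2

end GeneratingFunction

section Expansion

variable {n : ℕ}

lemma HarmonicBasis.continuous_val (Y : HarmonicBasis n) (i : HIndex n) : Continuous (Y.val i) :=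
  (MvPolynomial.continuous_eval _).comp (by fun_prop)

lemma HarmonicBasis.val_smul (Y : HarmonicBasis n) (i : HIndex n) (r : ℝ) (x : Space n) :
    Y.val i (r • x) = r ^ i.1 * Y.val i x :=
  eval_smul_of_isHomogeneous (mem_solidHarmonics.1 (Y.basis i.1 i.2).2).1 r fun m => x m

/-- The value `Y_{k,ℓ}(x / |x|)`, which at `x = 0` is read as `Y_{k,ℓ}(0)`. -/
def HarmonicBasis.angular (Y : HarmonicBasis n) (i : HIndex n) (x : Space n) : ℝ :=
  Y.val i (‖x‖⁻¹ • x)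

lemma HarmonicBasis.measurable_angular (Y : HarmonicBasis n) (i : HIndex n) :
    Measurable (Y.angular i) :=
  (Y.continuous_val i).measurable.comp (by fun_prop)

lemma HarmonicBasis.pow_mul_angular (Y : HarmonicBasis n) (i : HIndex n) (x : Space n) :
    ‖x‖ ^ i.1 * Y.angular i x = Y.val i x := by
  rw [HarmonicBasis.angular, ← Y.val_smul]
  rcases eq_or_ne x 0 with rfl | hx
  · simp
  · rw [smul_inv_smul₀ (norm_ne_zero_iff.2 hx)]

lemma HarmonicBasis.angular_smul_sphere (Y : HarmonicBasis n) (i : HIndex n) (θ : Sphere n) {r : ℝ}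
    (hr : 0 < r) : Y.angular i (r • (θ : Space n)) = Y.val i θ := by
  rw [HarmonicBasis.angular, norm_smul, norm_eq_of_mem_sphere, mul_one, Real.norm_of_nonneg hr.le,
    inv_smul_smul₀ hr.ne']

lemma norm_zpow_one_sub {ζ : ℂ} (hζ : ζ ≠ 0) (k : ℕ) : ‖ζ ^ (1 - (k : ℤ))‖ = ‖ζ‖ / ‖ζ‖ ^ k := by
  rw [zpow_sub₀ hζ, zpow_one, zpow_natCast, norm_div, norm_pow]

lemma one_le_harmonicDim (i : HIndex n) : (1 : ℝ) ≤ harmonicDim n i.1 := by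
  exact_mod_cast Nat.one_le_iff_ne_zero.2 (Fin.pos i.2).ne'

variable [NeZero n]

lemma integrable_sphere {E : Type*} [NormedAddCommGroup E] {f : Sphere n → E}
    (hf : Continuous f) : Integrable f (sphereMeasure n) :=
  hf.integrable_of_hasCompactSupport (.of_compactSpace _)

theorem zonalValue_one (Y : HarmonicBasis n) (k : ℕ) : zonalValue n 1 k = harmonicDim n k := by
  have sum_sq (θ : Sphere n) :
      ∑ l, Y.val ⟨k, l⟩ (θ : Space n) * Y.val ⟨k, l⟩ (θ : Space n) = zonalValue n 1 k := by
    rw [sum_val_mul_val_sphere, real_inner_self_eq_norm_sq, norm_eq_of_mem_sphere, one_pow]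
  have integral_sq (l) : ∫ θ : Sphere n, Y.val ⟨k, l⟩ (θ : Space n) * Y.val ⟨k, l⟩ (θ : Space n)
      ∂(sphereMeasure n) = 1 := (Y.orthonormal ⟨k, l⟩ ⟨k, l⟩).trans (if_pos rfl)
  calc zonalValue n 1 k
      = ∫ θ : Sphere n, ∑ l, Y.val ⟨k, l⟩ (θ : Space n) * Y.val ⟨k, l⟩ (θ : Space n)
          ∂(sphereMeasure n) := by simp [sum_sq]
    _ = harmonicDim n k := by
        rw [integral_finsetSum _ fun l _ => integrable_sphere
          (by have := Y.continuous_val ⟨k, l⟩; fun_prop)]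
        simp [integral_sq]

lemma abs_val_sphere_le (Y : HarmonicBasis n) (i : HIndex n) (θ : Sphere n) :
    |Y.val i θ| ≤ harmonicDim n i.1 := by
  refine abs_le_of_sq_le_sq ?_ (Nat.cast_nonneg _)
  calc Y.val i θ ^ 2 = Y.val i θ * Y.val i θ := sq _
    _ ≤ ∑ l, Y.val ⟨i.1, l⟩ (θ : Space n) * Y.val ⟨i.1, l⟩ (θ : Space n) :=
        Finset.single_le_sum (f := fun l => Y.val ⟨i.1, l⟩ (θ : Space n) *
          Y.val ⟨i.1, l⟩ (θ : Space n)) (fun l _ => mul_self_nonneg _) (Finset.mem_univ i.2)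
    _ = harmonicDim n i.1 := by
        rw [sum_val_mul_val_sphere, real_inner_self_eq_norm_sq, norm_eq_of_mem_sphere, one_pow,
          zonalValue_one Y]
    _ ≤ harmonicDim n i.1 ^ 2 := le_self_pow₀ (one_le_harmonicDim i) two_ne_zero

lemma abs_angular_le (Y : HarmonicBasis n) (i : HIndex n) (x : Space n) :
    |Y.angular i x| ≤ harmonicDim n i.1 := by
  rcases eq_or_ne x 0 with rfl | hx
  · obtain ⟨θ⟩ : Nonempty (Sphere n) := (NormedSpace.sphere_nonempty.2 zero_le_one).to_subtype
    have val_zero : Y.val i 0 = 0 ^ i.1 * Y.val i θ := by simpa using Y.val_smul i 0 θ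
    rw [HarmonicBasis.angular, smul_zero, val_zero, abs_mul, abs_pow, abs_zero]
    exact (mul_le_of_le_one_left (abs_nonneg _) (pow_le_one₀ le_rfl zero_le_one)).trans
      (abs_val_sphere_le Y i θ)
  · exact abs_val_sphere_le Y i ⟨‖x‖⁻¹ • x, by simp [norm_smul, hx]⟩

lemma summable_harmonicDim_sq_mul_pow (Y : HarmonicBasis n) {ρ : ℝ} (hρ : 0 ≤ ρ) (hρ' : ρ < 1) :
    Summable fun i : HIndex n => (harmonicDim n i.1 : ℝ) ^ 2 * ρ ^ i.1 := by
  refine (summable_sigma_of_nonneg fun i => by positivity).2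
    ⟨fun k => (hasSum_fintype _).summable, ?_⟩
  refine Summable.of_nonneg_of_le (fun k => tsum_nonneg fun l => by positivity) (fun k => ?_)
    (summable_sq_mul_pow (a := fun k => zonalValue n 1 k ^ 2)
      (fun ρ => summable_sq_mul_pow fun ρ => summable_zonalValue_one n) hρ hρ')
  have cube_le : harmonicDim n k * harmonicDim n k ^ 2 ≤ (harmonicDim n k ^ 2) ^ 2 := by
    rcases Nat.eq_zero_or_pos (harmonicDim n k) with h | h
    · simp [h]
    · rw [← pow_succ', ← pow_mul]
      exact Nat.pow_le_pow_right h (by norm_num)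
  rw [tsum_fintype, zonalValue_one Y]
  simp only [Finset.sum_const, Finset.card_univ, Fintype.card_fin, nsmul_eq_mul, ← mul_assoc]
  gcongr
  exact_mod_cast cube_le

lemma kernel_eq_gegenbauerGen (θ : Sphere n) (x : Space n) {ζ : ℂ} (hζ : ζ ≠ 0) :
    kernel ζ θ x =
      ζ⁻¹ * gegenbauerGen (n / 2) (inner ℝ (θ : Space n) (‖x‖⁻¹ • x)) (‖x‖ / ζ) := by
  have inner_mul_norm : ((inner ℝ (θ : Space n) (‖x‖⁻¹ • x) : ℝ) : ℂ) * ‖x‖ =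
      (inner ℝ (θ : Space n) x : ℝ) := by
    rw [real_inner_smul_right]
    rcases eq_or_ne x 0 with rfl | hx
    · simp
    · have : (‖x‖ : ℂ) ≠ 0 := by simpa using hx
      push_cast
      field_simp
  have base_eq : 1 - 2 * ((inner ℝ (θ : Space n) (‖x‖⁻¹ • x) : ℝ) : ℂ) * (‖x‖ / ζ) +
      (‖x‖ / ζ) ^ 2 = 1 - 2 * (inner ℝ (θ : Space n) x : ℝ) / ζ + (‖x‖ : ℂ) ^ 2 / ζ ^ 2 := by
    rw [← inner_mul_norm]
    ring
  have exponent_eq : (-((n / 2 : ℝ) : ℂ)) = -(n * (1 / 2)) := by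
    push_cast
    ring
  rw [gegenbauerGen, base_eq, kernel, distRoot, mul_pow, exponent_eq, Complex.cpow_neg,
    Complex.cpow_nat_mul, ← pow_sub_one_mul (NeZero.ne n) ζ]
  field_simp

lemma norm_pow_mul_sum_val_mul_angular (Y : HarmonicBasis n) (k : ℕ) (θ : Sphere n)
    (x : Space n) : ‖x‖ ^ k * ∑ l, Y.val ⟨k, l⟩ θ * Y.angular ⟨k, l⟩ x =
      ‖x‖ ^ k * zonalValue n (inner ℝ (θ : Space n) (‖x‖⁻¹ • x)) k := by
  rcases eq_or_ne x 0 with rfl | hx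
  · rcases k with _ | k
    · simp [HarmonicBasis.angular, sum_val_mul_val, zonal, zonalConst, zonalValue]
    · simp
  · congr 1
    exact sum_val_mul_val_sphere Y k θ ⟨‖x‖⁻¹ • x, by simp [norm_smul, hx]⟩

/-- The `(k,ℓ)` term of the expansion of the Hua–Aronszajn kernel in spherical harmonics. -/
def kernelTerm (Y : HarmonicBasis n) (ζ : ℂ) (θ : Sphere n) (i : HIndex n) (x : Space n) : ℂ :=
  ζ ^ (1 - (i.1 : ℤ)) * (Y.val i θ : ℂ) *
    (Y.angular i x * ((‖x‖ : ℂ) ^ i.1 / (ζ ^ 2 - (‖x‖ : ℂ) ^ 2)))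

lemma norm_kernelTerm_le (Y : HarmonicBasis n) (θ : Sphere n) {x : Space n} {ζ : ℂ} {R : ℝ}
    (hx : ‖x‖ ≤ R) (hR : R < ‖ζ‖) (i : HIndex n) :
    ‖kernelTerm Y ζ θ i x‖ ≤
      (‖ζ‖ / (‖ζ‖ ^ 2 - R ^ 2)) * ((harmonicDim n i.1 : ℝ) ^ 2 * (R / ‖ζ‖) ^ i.1) := by
  have R_nonneg : 0 ≤ R := (norm_nonneg x).trans hx
  have hζ : ζ ≠ 0 := norm_pos_iff.1 (R_nonneg.trans_lt hR)
  have denom_pos : 0 < ‖ζ‖ ^ 2 - R ^ 2 := by nlinarith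
  have denom_le : ‖ζ‖ ^ 2 - R ^ 2 ≤ ‖ζ ^ 2 - (‖x‖ : ℂ) ^ 2‖ := by
    have := norm_sub_norm_le (ζ ^ 2) ((‖x‖ : ℂ) ^ 2)
    rw [norm_pow, norm_pow, Complex.norm_real, norm_norm] at this
    nlinarith [norm_nonneg x]
  rw [kernelTerm, norm_mul, norm_mul, norm_mul, norm_zpow_one_sub hζ, norm_div, norm_pow,
    Complex.norm_real, Complex.norm_real, Complex.norm_real, norm_norm]
  calc _ ≤ ‖ζ‖ / ‖ζ‖ ^ i.1 * harmonicDim n i.1 * (harmonicDim n i.1 *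
        (R ^ i.1 / (‖ζ‖ ^ 2 - R ^ 2))) := by
        gcongr
        · exact abs_val_sphere_le Y i θ
        · exact abs_angular_le Y i x
    _ = _ := by
        rw [div_pow]
        ring

lemma summable_kernelTerm (Y : HarmonicBasis n) (θ : Sphere n) {x : Space n} {ζ : ℂ}
    (hx : ‖x‖ < ‖ζ‖) : Summable fun i => kernelTerm Y ζ θ i x :=
  .of_norm_bounded ((summable_harmonicDim_sq_mul_pow Y (by positivity)
    ((div_lt_one ((norm_nonneg x).trans_lt hx)).2 hx)).mul_left _)
    (norm_kernelTerm_le Y θ le_rfl hx)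

theorem hasSum_kernelTerm (Y : HarmonicBasis n) (θ : Sphere n) {x : Space n} {ζ : ℂ}
    (hx : ‖x‖ < ‖ζ‖) : HasSum (fun i => kernelTerm Y ζ θ i x) (kernel ζ θ x) := by
  have hζ : ζ ≠ 0 := norm_pos_iff.1 ((norm_nonneg x).trans_lt hx)
  set t := inner ℝ (θ : Space n) (‖x‖⁻¹ • x) with t_def
  have abs_t_le : |t| ≤ 1 := by
    refine (abs_real_inner_le_norm _ _).trans ?_
    rw [norm_eq_of_mem_sphere, one_mul, norm_smul, norm_inv, norm_norm]
    exact inv_mul_le_one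
  have norm_div_lt : ‖(‖x‖ / ζ : ℂ)‖ < 1 := by
    rwa [norm_div, Complex.norm_real, norm_norm, div_lt_one (norm_pos_iff.2 hζ)]
  have denom_ne_zero : ζ ^ 2 - (‖x‖ : ℂ) ^ 2 ≠ 0 := fun h => by
    have := congrArg norm (sub_eq_zero.1 h)
    rw [norm_pow, norm_pow, Complex.norm_real, norm_norm] at this
    exact hx.ne' ((pow_left_inj₀ (norm_nonneg _) (norm_nonneg _) two_ne_zero).1 this)
  have poisson_eq : ζ / (ζ ^ 2 - (‖x‖ : ℂ) ^ 2) * ((1 - (‖x‖ / ζ : ℂ) ^ 2) *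
      gegenbauerGen (n / 2) t (‖x‖ / ζ)) = kernel ζ θ x := by
    rw [kernel_eq_gegenbauerGen θ x hζ, ← t_def]
    field_simp
  refine HasSum.sigma_of_hasSum (poisson_eq ▸ (hasSum_zonalValue n abs_t_le norm_div_lt).mul_left
    (ζ / (ζ ^ 2 - (‖x‖ : ℂ) ^ 2))) (fun k => ?_) (summable_kernelTerm Y θ hx)
  convert! hasSum_fintype (_ : Fin (harmonicDim n k) → ℂ) using 1
  have addition := congrArg (fun r : ℝ => (r : ℂ)) (norm_pow_mul_sum_val_mul_angular Y k θ x)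
  simp only [Finset.mul_sum, ← t_def] at addition
  push_cast at addition
  calc _ = ζ ^ (1 - (k : ℤ)) / (ζ ^ 2 - (‖x‖ : ℂ) ^ 2) * ((‖x‖ : ℂ) ^ k * zonalValue n t k) := by
        rw [zpow_sub₀ hζ, zpow_one, zpow_natCast, div_pow]
        field_simp
    _ = ∑ l, kernelTerm Y ζ θ ⟨k, l⟩ x := by
        rw [← addition, Finset.mul_sum]
        exact Finset.sum_congr rfl fun l _ => by rw [kernelTerm]; ring

end Expansion

section Density

variable {α : Type*} [MeasurableSpace α] {m : Measure α} {E : Type*} [NormedAddCommGroup E]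
  [NormedSpace ℝ E]

lemma measurable_signType_sign_coe {g : α → ℝ} (hg : Measurable g) :
    Measurable fun x => ((SignType.sign (g x) : SignType) : ℝ) := by
  simp only [sign_apply, apply_ite (fun s : SignType => (s : ℝ))]
  exact .ite (measurableSet_lt measurable_const hg) measurable_const
    (.ite (measurableSet_lt hg measurable_const) measurable_const measurable_const)

lemma integrable_abs_smul_iff {g : α → ℝ} (hg : Measurable g) {f : α → E} :
    Integrable (fun x => |g x| • f x) m ↔ Integrable (fun x => g x • f x) m := by
  have sign_smul {u : α → E} (hu : Integrable u m) :
      Integrable ((fun x => ((SignType.sign (g x) : SignType) : ℝ)) • u) m :=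
    hu.bdd_smul 1 (measurable_signType_sign_coe hg).aestronglyMeasurable
      (.of_forall fun x => by rcases lt_trichotomy (g x) 0 with h | h | h <;> simp [h])
  refine ⟨fun h => (sign_smul h).congr (.of_forall fun x => ?_),
    fun h => (sign_smul h).congr (.of_forall fun x => ?_)⟩
  · simp only [Pi.smul_apply', smul_smul, sign_mul_abs]
  · simp only [Pi.smul_apply', smul_smul, sign_mul_self]

lemma integrable_withDensityᵥ_iff {g : α → ℝ} (hg : Integrable g m) (hgm : Measurable g)
    {f : α → E} : (m.withDensityᵥ g).Integrable f ↔ Integrable (fun x => g x • f x) m := by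
  rw [VectorMeasure.Integrable, Measure.variation_withDensityᵥ hg,
    integrable_withDensity_iff_integrable_smul₀' hgm.enorm.aemeasurable
      (.of_forall fun _ => enorm_lt_top)]
  simpa only [toReal_enorm, Real.norm_eq_abs] using integrable_abs_smul_iff hgm

lemma integrable_withDensity_ofReal_iff {h : α → ℝ} (hh : Measurable h) {f : α → E} :
    Integrable f (m.withDensity fun x => ENNReal.ofReal (h x)) ↔
      Integrable (fun x => max (h x) 0 • f x) m := by
  simpa only [ENNReal.toReal_ofReal'] using integrable_withDensity_iff_integrable_smul'
    hh.ennreal_ofReal (.of_forall fun _ => ENNReal.ofReal_lt_top)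

lemma integral_withDensity_ofReal {h : α → ℝ} (hh : Measurable h) (f : α → E) :
    ∫ x, f x ∂(m.withDensity fun x => ENNReal.ofReal (h x)) = ∫ x, max (h x) 0 • f x ∂m := by
  simp_rw [integral_withDensity_eq_integral_toReal_smul hh.ennreal_ofReal
    (.of_forall fun _ => ENNReal.ofReal_lt_top), ENNReal.toReal_ofReal']

lemma integrable_max_zero_smul {g : α → ℝ} (hg : Measurable g) {f : α → E}
    (hf : Integrable (fun x => g x • f x) m) : Integrable (fun x => max (g x) 0 • f x) m := by
  refine ((hf.add ((integrable_abs_smul_iff hg).2 hf)).smul (2⁻¹ : ℝ)).congr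
    (.of_forall fun x => ?_)
  simp only [Pi.smul_apply, Pi.add_apply, ← add_smul, smul_smul]
  rcases le_total (g x) 0 with h | h
  · simp [h, abs_of_nonpos]
  · simp only [abs_of_nonneg h, max_eq_left h]
    ring_nf

lemma integral_withDensityᵥ {g : α → ℝ} (hg : Integrable g m)
    (hgm : Measurable g) {f : α → E} (hf : Integrable (fun x => g x • f x) m) :
    ∫ᵛ x, f x ∂<•(m.withDensityᵥ g) = ∫ x, g x • f x ∂m := by
  have integrable_pos := integrable_max_zero_smul hgm hf
  have integrable_neg := integrable_max_zero_smul (f := f) hgm.neg (m := m)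
    (hf.neg.congr (.of_forall fun x => (neg_smul _ _).symm))
  have := isFiniteMeasure_withDensity_ofReal hg.2
  have := isFiniteMeasure_withDensity_ofReal hg.neg.2
  have vectorIntegrable {ν : Measure α} [IsFiniteMeasure ν] (h : Integrable f ν) :
      ν.toSignedMeasure.Integrable f := by
    rwa [VectorMeasure.Integrable, Measure.variation_toSignedMeasure]
  calc ∫ᵛ x, f x ∂<•(m.withDensityᵥ g)
      = ∫ x, f x ∂(m.withDensity fun x => ENNReal.ofReal (g x)) -
          ∫ x, f x ∂(m.withDensity fun x => ENNReal.ofReal ((-g) x)) := by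
        rw [← VectorMeasure.integral_toSignedMeasure, ← VectorMeasure.integral_toSignedMeasure,
          ← VectorMeasure.integral_sub_vectorMeasure
            (vectorIntegrable ((integrable_withDensity_ofReal_iff hgm).2 integrable_pos))
            (vectorIntegrable ((integrable_withDensity_ofReal_iff hgm.neg).2 integrable_neg))]
        exact congrArg (fun ν : SignedMeasure α => ∫ᵛ x, f x ∂<•ν)
          (withDensityᵥ_eq_withDensity_pos_part_sub_withDensity_neg_part hg)
    _ = ∫ x, g x • f x ∂m := by
        rw [integral_withDensity_ofReal hgm, integral_withDensity_ofReal hgm.neg,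
          ← integral_sub integrable_pos integrable_neg]
        simp only [← sub_smul, Pi.neg_apply, max_zero_sub_max_neg_zero_eq_self]

lemma exists_eq_withDensityᵥ (μ : SignedMeasure α) : ∃ (m : Measure α) (g : α → ℝ),
    Measurable g ∧ Integrable g m ∧ μ = m.withDensityᵥ g := by
  refine ⟨μ.totalVariation, μ.rnDeriv μ.totalVariation, SignedMeasure.measurable_rnDeriv _ _,
    SignedMeasure.integrable_rnDeriv _ _, (SignedMeasure.withDensityᵥ_rnDeriv_eq μ _ ?_).symm⟩
  refine VectorMeasure.AbsolutelyContinuous.mk fun s hs h => ?_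
  rw [Measure.toENNRealVectorMeasure_apply_measurable hs] at h
  exact SignedMeasure.null_of_totalVariation_zero _ h

instance isFiniteMeasure_variation (μ : SignedMeasure α) : IsFiniteMeasure μ.variation := by
  rw [← SignedMeasure.totalVariation_eq_variation]
  infer_instance

lemma eq_toSignedMeasure_variation_of_nonneg {μ : SignedMeasure α} (hμ : 0 ≤ μ) :
    μ = μ.variation.toSignedMeasure := by
  have h := SignedMeasure.toMeasureOfZeroLE_toSignedMeasure μ
    ((VectorMeasure.le_restrict_univ_iff_le _ _).2 hμ)
  conv_rhs => rw [Measure.toSignedMeasure_congr (by rw [← h, Measure.variation_toSignedMeasure])]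
  exact h.symm

end Density

section Component

variable {n : ℕ} {E : Type*} [NormedAddCommGroup E] [NormedSpace ℝ E]

lemma integrable_angular [NeZero n] (Y : HarmonicBasis n) (i : HIndex n) {m : Measure (Space n)}
    {f : Space n → E} (hf : Integrable f m) : Integrable (fun x => Y.angular i x • f x) m :=
  hf.bdd_smul (harmonicDim n i.1) (Y.measurable_angular i).aestronglyMeasurable
    (.of_forall (abs_angular_le Y i))

lemma withDensity_angular [NeZero n] (Y : HarmonicBasis n) (i : HIndex n)
    {m : Measure (Space n)} {g : Space n → ℝ} (hg : Integrable g m) (hgm : Measurable g) :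
    (m.withDensityᵥ g).withDensity (Y.angular i) (ContinuousLinearMap.lsmul ℝ ℝ).flip =
      m.withDensityᵥ (fun x => Y.angular i x * g x) := by
  have integrable_mul : Integrable (fun x => Y.angular i x * g x) m := integrable_angular Y i hg
  have integrable_smul : Integrable (fun x => g x • Y.angular i x) m := by
    simpa only [smul_eq_mul, mul_comm] using integrable_mul
  ext s hs
  rw [VectorMeasure.withDensity_apply ((integrable_withDensityᵥ_iff hg hgm).2 integrable_smul),
    ← VectorMeasure.integral_indicator hs, withDensityᵥ_apply integrable_mul hs,
    integral_withDensityᵥ hg hgm, ← integral_indicator hs]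
  · refine integral_congr_ae (.of_forall fun x => ?_)
    by_cases hx : x ∈ s <;> simp [hx, mul_comm]
  · refine (integrable_smul.indicator hs).congr (.of_forall fun x => ?_)
    by_cases hx : x ∈ s <;> simp [hx]

lemma component_withDensityᵥ [NeZero n] (Y : HarmonicBasis n) (i : HIndex n)
    {m : Measure (Space n)} {g : Space n → ℝ} (hg : Integrable g m) (hgm : Measurable g) :
    component Y (m.withDensityᵥ g) i =
      (m.withDensityᵥ (fun x => Y.angular i x * g x)).map (fun x => ‖x‖) := by
  rw [← withDensity_angular Y i hg hgm]
  rfl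

/-- The component `μ_{k,ℓ}` as a nonnegative measure. It is encoded as the variation of the signed
measure `component Y μ i`, which agrees with the component itself when `μ` is pseudo-positive. -/
def compMeasure (Y : HarmonicBasis n) (μ : SignedMeasure (Space n)) (i : HIndex n) : Measure ℝ :=
  (component Y μ i).variation

instance (Y : HarmonicBasis n) (μ : SignedMeasure (Space n)) (i : HIndex n) :
    IsFiniteMeasure (compMeasure Y μ i) :=
  isFiniteMeasure_variation _

lemma IsPseudoPositive.component_eq_toSignedMeasure {Y : HarmonicBasis n}
    {μ : SignedMeasure (Space n)} (hμ : IsPseudoPositive Y μ) (i : HIndex n) :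
    component Y μ i = (compMeasure Y μ i).toSignedMeasure :=
  eq_toSignedMeasure_variation_of_nonneg (hμ i)

lemma integrable_component [NeZero n] (Y : HarmonicBasis n) {μ : SignedMeasure (Space n)}
    (i : HIndex n) {f : ℝ → E} (hfm : StronglyMeasurable f)
    (hf : μ.Integrable fun x => Y.angular i x • f ‖x‖) : (component Y μ i).Integrable f := by
  obtain ⟨m, g, hgm, hg, rfl⟩ := exists_eq_withDensityᵥ μ
  rw [component_withDensityᵥ Y i hg hgm]
  refine VectorMeasure.Integrable.map hfm.aestronglyMeasurable
    ((integrable_withDensityᵥ_iff (integrable_angular Y i hg)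
      ((Y.measurable_angular i).mul hgm)).2 ?_)
  refine ((integrable_withDensityᵥ_iff hg hgm).1 hf).congr (.of_forall fun x => ?_)
  simp only [smul_smul, smul_eq_mul, Function.comp, mul_comm]

lemma integral_component [NeZero n] (Y : HarmonicBasis n)
    {μ : SignedMeasure (Space n)} (i : HIndex n) {f : ℝ → E} (hfm : StronglyMeasurable f)
    (hf : μ.Integrable fun x => Y.angular i x • f ‖x‖) :
    ∫ᵛ r, f r ∂<•(component Y μ i) = ∫ᵛ x, Y.angular i x • f ‖x‖ ∂<•μ := by
  obtain ⟨m, g, hgm, hg, rfl⟩ := exists_eq_withDensityᵥ μ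
  have integrable_mul : Integrable (fun x => Y.angular i x * g x) m := integrable_angular Y i hg
  have measurable_mul : Measurable fun x => Y.angular i x * g x := (Y.measurable_angular i).mul hgm
  have integrable_smul := (integrable_withDensityᵥ_iff hg hgm).1 hf
  have integrable_mul_smul : Integrable (fun x => (Y.angular i x * g x) • f ‖x‖) m := by
    simpa only [smul_smul, mul_comm] using integrable_smul
  rw [component_withDensityᵥ Y i hg hgm, VectorMeasure.integral_map measurable_norm
    hfm.aestronglyMeasurable
    ((integrable_withDensityᵥ_iff integrable_mul measurable_mul).2 integrable_mul_smul)]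
  refine (integral_withDensityᵥ integrable_mul measurable_mul integrable_mul_smul).trans ?_
  simp only [integral_withDensityᵥ hg hgm integrable_smul, smul_smul, mul_comm]

lemma IsPseudoPositive.integral_compMeasure [NeZero n] {Y : HarmonicBasis n}
    {μ : SignedMeasure (Space n)} (hμ : IsPseudoPositive Y μ) (i : HIndex n) {f : ℝ → E}
    (hfm : StronglyMeasurable f) (hf : μ.Integrable fun x => Y.angular i x • f ‖x‖) :
    ∫ r, f r ∂(compMeasure Y μ i) = ∫ᵛ x, Y.angular i x • f ‖x‖ ∂<•μ := by
  rw [← integral_component Y i hfm hf, hμ.component_eq_toSignedMeasure i,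
    VectorMeasure.integral_toSignedMeasure]

lemma ae_nonneg_compMeasure (Y : HarmonicBasis n) (μ : SignedMeasure (Space n)) (i : HIndex n) :
    ∀ᵐ r ∂(compMeasure Y μ i), 0 ≤ r := by
  have preimage_eq : (fun x : Space n => ‖x‖) ⁻¹' Set.Iio 0 = ∅ := by
    ext x
    simp
  have variation_Iio : compMeasure Y μ i (Set.Iio 0) ≤ 0 := by
    refine (VectorMeasure.variation_map_le (Set.Iio 0)).trans ?_
    rw [Measure.map_apply measurable_norm measurableSet_Iio, preimage_eq, measure_empty]
  rw [ae_iff]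
  simpa [Set.Iio] using variation_Iio

lemma component_truncation [NeZero n] (Y : HarmonicBasis n) (μ : SignedMeasure (Space n)) (R : ℝ)
    (i : HIndex n) : component Y (truncation μ R) i = (component Y μ i).restrict (Set.Iic R) := by
  have integrable_angular : μ.Integrable (Y.angular i) :=
    .of_bound (Y.measurable_angular i).aestronglyMeasurable (harmonicDim n i.1)
      (.of_forall (abs_angular_le Y i))
  have closedBall_eq : Metric.closedBall (0 : Space n) R = (fun x => ‖x‖) ⁻¹' Set.Iic R := by
    ext x
    simp
  change ((μ.restrict _).withDensity (Y.angular i) _).map _ =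
    ((μ.withDensity (Y.angular i) _).map _).restrict _
  rw [← VectorMeasure.restrict_withDensity integrable_angular]
  ext s hs
  rw [VectorMeasure.map_apply _ measurable_norm hs, VectorMeasure.restrict_apply _
    measurableSet_Iic hs, VectorMeasure.map_apply _ measurable_norm (hs.inter measurableSet_Iic),
    VectorMeasure.restrict_apply _ measurableSet_closedBall (measurable_norm hs), closedBall_eq]
  rfl

lemma compMeasure_truncation [NeZero n] (Y : HarmonicBasis n) (μ : SignedMeasure (Space n))
    (R : ℝ) (i : HIndex n) :
    compMeasure Y (truncation μ R) i = (compMeasure Y μ i).restrict (Set.Iic R) := by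
  rw [compMeasure, component_truncation, VectorMeasure.variation_restrict measurableSet_Iic]
  rfl

protected lemma IsPseudoPositive.truncation [NeZero n] {Y : HarmonicBasis n}
    {μ : SignedMeasure (Space n)} (hμ : IsPseudoPositive Y μ) (R : ℝ) :
    IsPseudoPositive Y (truncation μ R) := fun i => by
  rw [component_truncation, hμ.component_eq_toSignedMeasure i,
    Measure.toSignedMeasure_restrict_eq_restrict_toSignedMeasure _ _ measurableSet_Iic]
  exact Measure.zero_le_toSignedMeasure _

end Component

section Convergence

variable {n : ℕ} {Y : HarmonicBasis n} {μ : SignedMeasure (Space n)} {s : HIndex n → ℕ → ℝ}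
  {J : ℕ} {C D : ℝ}

/-- The component measures satisfy `∫ r^k dμ_{k,ℓ} ≤ C d_k D^k`: the form of the growth condition
which holds both for `μ` itself and, with `D = R`, for its truncation to the ball of radius `R`. -/
def MomentBound (Y : HarmonicBasis n) (μ : SignedMeasure (Space n)) (C D : ℝ) : Prop :=
  ∀ i, Integrable (fun r : ℝ => r ^ i.1) (compMeasure Y μ i) ∧
    ∫ r, r ^ i.1 ∂(compMeasure Y μ i) ≤ C * harmonicDim n i.1 * D ^ i.1

/-- The squares of almost all radii charged by the components of `μ` keep distance at least `ε`
from `z`, so that the Cauchy kernels `1 / (z - r²)` are bounded by `1 / ε`. -/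
def IsSeparated (Y : HarmonicBasis n) (μ : SignedMeasure (Space n)) (ε : ℝ) (z : ℂ) : Prop :=
  ∀ i, ∀ᵐ r : ℝ ∂(compMeasure Y μ i), ε ≤ ‖z - (r : ℂ) ^ 2‖

lemma angular_smul_norm_pow (Y : HarmonicBasis n) (i : HIndex n) (j : ℕ) (x : Space n) :
    Y.angular i x • ‖x‖ ^ (i.1 + 2 * j) = ‖x‖ ^ (2 * j) * Y.val i x := by
  rw [← Y.pow_mul_angular, smul_eq_mul, pow_add]
  ring

lemma SolvesMomentProblem.integrable_pow [NeZero n] (hs : SolvesMomentProblem Y μ s J)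
    (i : HIndex n) {j : ℕ} (hj : j ≤ J) :
    Integrable (fun r : ℝ => r ^ (i.1 + 2 * j)) (compMeasure Y μ i) := by
  refine integrable_component Y i (by fun_prop : Measurable _).stronglyMeasurable ?_
  simpa only [angular_smul_norm_pow] using (hs i j hj).1

lemma SolvesMomentProblem.integral_pow [NeZero n] (hs : SolvesMomentProblem Y μ s J)
    (hμ : IsPseudoPositive Y μ) (i : HIndex n) {j : ℕ} (hj : j ≤ J) :
    ∫ r, r ^ (i.1 + 2 * j) ∂(compMeasure Y μ i) = s i j := by
  rw [(hs i j hj).2, hμ.integral_compMeasure i (by fun_prop : Measurable _).stronglyMeasurable]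
  · simp only [angular_smul_norm_pow]
  · simpa only [angular_smul_norm_pow] using (hs i j hj).1

lemma SolvesMomentProblem.momentBound [NeZero n] (hs : SolvesMomentProblem Y μ s J)
    (hμ : IsPseudoPositive Y μ) (hC : 0 ≤ C) (hD : 0 ≤ D) (hg : GrowthBound s C D) :
    MomentBound Y μ C D := fun i => by
  refine ⟨by simpa using hs.integrable_pow i J.zero_le, ?_⟩
  calc ∫ r, r ^ i.1 ∂(compMeasure Y μ i) = s i 0 := by simpa using hs.integral_pow hμ i J.zero_le
    _ ≤ C * D ^ i.1 := (le_abs_self _).trans (hg i)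
    _ ≤ C * D ^ i.1 * harmonicDim n i.1 :=
        le_mul_of_one_le_right (by positivity) (one_le_harmonicDim i)
    _ = C * harmonicDim n i.1 * D ^ i.1 := mul_right_comm _ _ _

lemma IsPseudoPositive.compMeasure_real_univ_le [NeZero n] (hμ : IsPseudoPositive Y μ)
    (i : HIndex n) :
    (compMeasure Y μ i).real Set.univ ≤ harmonicDim n i.1 * μ.variation.real Set.univ := by
  have mass_eq := hμ.integral_compMeasure i (f := fun _ => (1 : ℝ)) stronglyMeasurable_const
    (integrable_angular Y i (integrable_const 1))
  rw [integral_const, smul_eq_mul, mul_one] at mass_eq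
  rw [mass_eq]
  refine (Real.le_norm_self _).trans ((VectorMeasure.norm_integral_le_of_norm_le_const
    (C := (harmonicDim n i.1 : ℝ)) (.of_forall fun x => ?_)).trans ?_)
  · simpa using abs_angular_le Y i x
  · refine mul_le_mul_of_nonneg_right (mul_le_of_le_one_right (by positivity) ?_) (by positivity)
    rw [ContinuousLinearMap.opNorm_flip]
    exact ContinuousLinearMap.opNorm_lsmul_le

lemma ae_compMeasure_truncation_mem_Icc [NeZero n] (Y : HarmonicBasis n)
    (μ : SignedMeasure (Space n)) (R : ℝ) (i : HIndex n) :
    ∀ᵐ r ∂(compMeasure Y (truncation μ R) i), r ∈ Set.Icc 0 R := by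
  rw [compMeasure_truncation]
  exact (ae_restrict_of_ae (ae_nonneg_compMeasure Y μ i)).and (ae_restrict_mem measurableSet_Iic)

lemma IsPseudoPositive.momentBound_truncation [NeZero n] (hμ : IsPseudoPositive Y μ) {R : ℝ}
    (hR : 0 ≤ R) : MomentBound Y (truncation μ R) (μ.variation.real Set.univ) R := fun i => by
  have norm_pow_le : ∀ᵐ r ∂compMeasure Y (truncation μ R) i, ‖r ^ i.1‖ ≤ R ^ i.1 := by
    filter_upwards [ae_compMeasure_truncation_mem_Icc Y μ R i] with r hr
    rw [norm_pow, Real.norm_of_nonneg hr.1]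
    exact pow_le_pow_left₀ hr.1 hr.2 _
  refine ⟨.of_bound (by fun_prop) _ norm_pow_le, ?_⟩
  calc ∫ r, r ^ i.1 ∂compMeasure Y (truncation μ R) i
      ≤ R ^ i.1 * (compMeasure Y (truncation μ R) i).real Set.univ :=
        (Real.le_norm_self _).trans (norm_integral_le_of_norm_le_const norm_pow_le)
    _ ≤ R ^ i.1 * (compMeasure Y μ i).real Set.univ := by
        rw [compMeasure_truncation, measureReal_restrict_apply_univ]
        gcongr
        exacts [measure_ne_top _ _, Set.subset_univ _]
    _ ≤ R ^ i.1 * (harmonicDim n i.1 * μ.variation.real Set.univ) := by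
        gcongr
        exact hμ.compMeasure_real_univ_le i
    _ = _ := by ring

lemma isSeparated_truncation [NeZero n] (Y : HarmonicBasis n) (μ : SignedMeasure (Space n))
    (R : ℝ) (z : ℂ) : IsSeparated Y (truncation μ R) (‖z‖ - R ^ 2) z := fun i => by
  filter_upwards [ae_compMeasure_truncation_mem_Icc Y μ R i] with r hr
  refine le_trans ?_ (norm_sub_norm_le z ((r : ℂ) ^ 2))
  rw [norm_pow, Complex.norm_real, Real.norm_of_nonneg hr.1]
  gcongr
  exacts [hr.1, hr.2]

protected lemma IsSeparated.truncation [NeZero n] {ε : ℝ} {z : ℂ} (h : IsSeparated Y μ ε z)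
    (R : ℝ) : IsSeparated Y (truncation μ R) ε z := fun i => by
  rw [compMeasure_truncation]
  exact ae_restrict_of_ae (h i)

lemma IsPseudoPositive.componentTransform_eq (hμ : IsPseudoPositive Y μ) (i : HIndex n) (z : ℂ) :
    componentTransform Y μ i z = ∫ r, (r : ℂ) ^ i.1 / (z - (r : ℂ) ^ 2) ∂(compMeasure Y μ i) := by
  rw [componentTransform, hμ.component_eq_toSignedMeasure i,
    VectorMeasure.integral_toSignedMeasure]

lemma ae_norm_cauchy_le {ν : Measure ℝ} {z : ℂ} {ε : ℝ} (hε : 0 < ε) (k : ℕ)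
    (h : ∀ᵐ r : ℝ ∂ν, ε ≤ ‖z - (r : ℂ) ^ 2‖) :
    ∀ᵐ r : ℝ ∂ν, ‖(r : ℂ) ^ k / (z - (r : ℂ) ^ 2)‖ ≤ ‖r ^ k‖ / ε := by
  filter_upwards [h] with r hr
  rw [norm_div, norm_pow, Complex.norm_real, ← norm_pow]
  gcongr

lemma integrable_cauchy {ν : Measure ℝ} {z : ℂ} {ε : ℝ} (hε : 0 < ε) {k : ℕ}
    (h : ∀ᵐ r : ℝ ∂ν, ε ≤ ‖z - (r : ℂ) ^ 2‖) (hk : Integrable (fun r : ℝ => r ^ k) ν) :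
    Integrable (fun r : ℝ => (r : ℂ) ^ k / (z - (r : ℂ) ^ 2)) ν :=
  (hk.norm.div_const ε).mono' (Measurable.aestronglyMeasurable (by fun_prop))
    (ae_norm_cauchy_le hε k h)

namespace MomentBound

lemma integral_norm_cauchy_le (hM : MomentBound Y μ C D) (i : HIndex n) {z : ℂ} {ε : ℝ}
    (hε : 0 < ε) (h : IsSeparated Y μ ε z) :
    ∫ r, ‖(r : ℂ) ^ i.1 / (z - (r : ℂ) ^ 2)‖ ∂(compMeasure Y μ i) ≤
      C * harmonicDim n i.1 * D ^ i.1 / ε :=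
  calc ∫ r, ‖(r : ℂ) ^ i.1 / (z - (r : ℂ) ^ 2)‖ ∂(compMeasure Y μ i)
      ≤ ∫ r, ‖r ^ i.1‖ / ε ∂(compMeasure Y μ i) :=
        integral_mono_ae (integrable_cauchy hε (h i) (hM i).1).norm ((hM i).1.norm.div_const ε)
          (ae_norm_cauchy_le hε i.1 (h i))
    _ = (∫ r, r ^ i.1 ∂(compMeasure Y μ i)) / ε := by
        rw [integral_div]
        congr 1
        refine integral_congr_ae ?_
        filter_upwards [ae_nonneg_compMeasure Y μ i] with r hr
        exact Real.norm_of_nonneg (pow_nonneg hr _)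
    _ ≤ C * harmonicDim n i.1 * D ^ i.1 / ε := by
        gcongr
        exact (hM i).2

lemma norm_transformTerm_le [NeZero n] (hM : MomentBound Y μ C D) (i : HIndex n) {ζ : ℂ}
    (hζ : ζ ≠ 0) {ε : ℝ} (hε : 0 < ε) (h : IsSeparated Y μ ε (ζ ^ 2)) (θ : Sphere n) :
    ‖ζ ^ (1 - (i.1 : ℤ))‖ * |Y.val i θ| *
        ∫ r, ‖(r : ℂ) ^ i.1 / (ζ ^ 2 - (r : ℂ) ^ 2)‖ ∂(compMeasure Y μ i) ≤
      ‖ζ‖ * C / ε * ((harmonicDim n i.1 : ℝ) ^ 2 * (D / ‖ζ‖) ^ i.1) := by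
  rw [norm_zpow_one_sub hζ]
  calc _ ≤ ‖ζ‖ / ‖ζ‖ ^ i.1 * harmonicDim n i.1 * (C * harmonicDim n i.1 * D ^ i.1 / ε) := by
        gcongr
        · exact abs_val_sphere_le Y i θ
        · exact hM.integral_norm_cauchy_le i hε h
    _ = _ := by
        rw [div_pow]
        ring

end MomentBound

lemma summable_harmonicDim_sq_mul_div_pow [NeZero n] (Y : HarmonicBasis n) (hD : 0 ≤ D) {a : ℝ}
    (ha : D < a) (b : ℝ) :
    Summable fun i : HIndex n => b * ((harmonicDim n i.1 : ℝ) ^ 2 * (D / a) ^ i.1) :=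
  (summable_harmonicDim_sq_mul_pow Y (div_nonneg hD (hD.trans ha.le))
    ((div_lt_one (hD.trans_lt ha)).2 ha)).mul_left _

namespace MomentBound

variable [NeZero n] {ζ : ℂ} {ε : ℝ}

theorem transformConverges (hM : MomentBound Y μ C D) (hD : 0 ≤ D) (hζ : D < ‖ζ‖) (hε : 0 < ε)
    (h : IsSeparated Y μ ε (ζ ^ 2)) (θ : Sphere n) : TransformConverges Y μ ζ θ := by
  refine ⟨fun i => integrable_cauchy hε (h i) (hM i).1, .of_nonneg_of_le (fun i => ?_)
    (fun i => hM.norm_transformTerm_le i (norm_pos_iff.1 (hD.trans_lt hζ)) hε h θ)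
    (summable_harmonicDim_sq_mul_div_pow Y hD hζ _)⟩
  exact mul_nonneg (by positivity) (integral_nonneg fun _ => norm_nonneg _)

lemma norm_transform_summand_le (hM : MomentBound Y μ C D) (hμ : IsPseudoPositive Y μ)
    (i : HIndex n) (hζ : ζ ≠ 0) (hε : 0 < ε) (h : IsSeparated Y μ ε (ζ ^ 2)) (θ : Sphere n) :
    ‖ζ ^ (1 - (i.1 : ℤ)) * (Y.val i θ : ℂ) * componentTransform Y μ i (ζ ^ 2)‖ ≤
      ‖ζ‖ * C / ε * ((harmonicDim n i.1 : ℝ) ^ 2 * (D / ‖ζ‖) ^ i.1) := by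
  refine le_trans ?_ (hM.norm_transformTerm_le i hζ hε h θ)
  rw [norm_mul, norm_mul, Complex.norm_real, Real.norm_eq_abs, hμ.componentTransform_eq]
  gcongr
  exact norm_integral_le_integral_norm _

theorem hasSum_transform (hM : MomentBound Y μ C D) (hμ : IsPseudoPositive Y μ) (hD : 0 ≤ D)
    (hζ : D < ‖ζ‖) (hε : 0 < ε) (h : IsSeparated Y μ ε (ζ ^ 2)) (θ : Sphere n) :
    HasSum (fun i : HIndex n =>
      ζ ^ (1 - (i.1 : ℤ)) * (Y.val i θ : ℂ) * componentTransform Y μ i (ζ ^ 2))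
      (transform Y μ ζ θ) :=
  (Summable.of_norm_bounded (summable_harmonicDim_sq_mul_div_pow Y hD hζ _) fun i =>
    hM.norm_transform_summand_le hμ i (norm_pos_iff.1 (hD.trans_lt hζ)) hε h θ).hasSum

protected lemma truncation (hM : MomentBound Y μ C D) (R : ℝ) :
    MomentBound Y (truncation μ R) C D := fun i => by
  rw [compMeasure_truncation]
  refine ⟨(hM i).1.restrict, (setIntegral_le_integral (hM i).1 ?_).trans (hM i).2⟩
  filter_upwards [ae_nonneg_compMeasure Y μ i] with r hr using pow_nonneg hr _

theorem tendsto_transform_truncation (hM : MomentBound Y μ C D) (hμ : IsPseudoPositive Y μ)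
    (hD : 0 ≤ D) (hζ : D < ‖ζ‖) (hε : 0 < ε) (h : IsSeparated Y μ ε (ζ ^ 2)) (θ : Sphere n) :
    Tendsto (fun R : ℝ => transform Y (truncation μ R) ζ θ) atTop
      (𝓝 (transform Y μ ζ θ)) := by
  refine tendsto_tsum_of_dominated_convergence (summable_harmonicDim_sq_mul_div_pow Y hD hζ _)
    (fun i => .const_mul _ ?_) (.of_forall fun R i =>
      (hM.truncation R).norm_transform_summand_le (hμ.truncation R) i
        (norm_pos_iff.1 (hD.trans_lt hζ)) hε (h.truncation R) θ)
  simp only [hμ.componentTransform_eq, (hμ.truncation _).componentTransform_eq,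
    compMeasure_truncation]
  exact (aecover_Iic tendsto_id).integral_tendsto_of_countably_generated
    (integrable_cauchy hε (h i) (hM i).1)

end MomentBound

end Convergence

section Quadric

variable {n : ℕ}

lemma KDQ.continuous_mk : Continuous fun p : ℂ × Sphere n => KDQ.mk p.1 p.2 :=
  continuous_quotient_mk'

lemma KDQ.eq_or_eq_neg_of_mk_eq_mk {ζ ξ : ℂ} {θ η : Sphere n} (h : KDQ.mk ζ θ = KDQ.mk ξ η) :
    ξ = ζ ∨ ξ = -ζ :=
  (Quotient.exact h).imp (congrArg Prod.fst) (congrArg Prod.fst)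

/-- A function of `(ζ, θ)` invariant under the antipodal map, as a function of `ζθ`. -/
def KDQ.lift {α : Type*} (f : ℂ → Sphere n → α) (hf : ∀ ζ θ, f (-ζ) (-θ) = f ζ θ) : KDQ n → α :=
  Quotient.lift (fun p : ℂ × Sphere n => f p.1 p.2) (by
    rintro p q (rfl | rfl)
    · rfl
    · exact (hf p.1 p.2).symm)

lemma KDQ.lift_mk {α : Type*} {f : ℂ → Sphere n → α} (hf : ∀ ζ θ, f (-ζ) (-θ) = f ζ θ)
    (ζ : ℂ) (θ : Sphere n) : KDQ.lift f hf (KDQ.mk ζ θ) = f ζ θ := rfl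

lemma KDQ.exists_eq_mk (q : KDQ n) : ∃ (ζ : ℂ) (θ : Sphere n), q = KDQ.mk ζ θ := by
  induction q using Quotient.inductionOn with
  | h p => exact ⟨p.1, p.2, rfl⟩

lemma KDQ.exists_forall_le_of_isCompact {f : ℂ → ℝ} (hf : Continuous f) (hf' : ∀ ζ, f (-ζ) = f ζ)
    {K : Set (KDQ n)} (hK : IsCompact K) {a : ℝ} (ha : ∀ ζ θ, KDQ.mk ζ θ ∈ K → a < f ζ) :
    ∃ b, a < b ∧ ∀ (ζ : ℂ) (θ : Sphere n), KDQ.mk ζ θ ∈ K → b ≤ f ζ := by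
  have continuous_lift : Continuous (KDQ.lift (n := n) (fun ζ _ => f ζ) fun ζ _ => hf' ζ) :=
    Continuous.quotient_lift (by fun_prop) _
  obtain ⟨b, hab, hb⟩ := hK.exists_forall_le' continuous_lift.continuousOn (a := a) (by
    intro q hq
    obtain ⟨ζ, θ, rfl⟩ := q.exists_eq_mk
    exact ha ζ θ hq)
  exact ⟨b, hab, fun ζ θ h => hb _ h⟩

lemma KDQ.lt_norm_of_mem_exterior {R : ℝ} (hR : 0 < R) {ζ : ℂ} {θ : Sphere n}
    (h : KDQ.mk ζ θ ∈ KDQ.exterior n R) : R < ‖ζ‖ := by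
  by_contra! norm_le
  have continuous_ray : Continuous fun c : ℝ => KDQ.mk ((c : ℂ) * ζ) θ :=
    KDQ.continuous_mk.comp (f := fun c : ℝ => ((c : ℂ) * ζ, θ)) (by fun_prop)
  have tendsto_ray : Tendsto (fun c : ℝ => KDQ.mk ((c : ℂ) * ζ) θ) (𝓝[<] 1)
      (𝓝 (KDQ.mk ζ θ)) := by
    simpa using (continuous_ray.tendsto 1).mono_left (nhdsWithin_le_nhds (s := Set.Iio 1))
  refine h (mem_closure_of_tendsto tendsto_ray ?_)
  filter_upwards [Ioo_mem_nhdsLT (zero_lt_one' ℝ)] with c hc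
  refine ⟨_, θ, ?_, rfl⟩
  rw [norm_mul, Complex.norm_real, Real.norm_of_nonneg hc.1.le]
  calc c * ‖ζ‖ ≤ c * R := mul_le_mul_of_nonneg_left norm_le hc.1.le
    _ < R := mul_lt_of_lt_one_left hR hc.2

lemma KDQ.sq_ne_of_mem_slit {ζ : ℂ} {θ : Sphere n} (h : KDQ.mk ζ θ ∈ KDQ.slit n) (t : ℝ)
    (ht : 0 ≤ t) : ζ ^ 2 ≠ (t : ℂ) := by
  obtain ⟨ξ, η, hξ, mk_eq⟩ := h
  rcases KDQ.eq_or_eq_neg_of_mk_eq_mk mk_eq with rfl | rfl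
  · exact hξ t ht
  · simpa using hξ t ht

lemma transform_neg (Y : HarmonicBasis n) (μ : SignedMeasure (Space n)) (ζ : ℂ) (θ : Sphere n) :
    transform Y μ (-ζ) (-θ) = -transform Y μ ζ θ := by
  rw [transform, transform, ← tsum_neg]
  refine tsum_congr fun i => ?_
  have val_neg : Y.val i ((-θ : Sphere n) : Space n) = (-1) ^ i.1 * Y.val i θ := by
    rw [← Y.val_smul]
    simp
  have zpow_neg : (-ζ) ^ (1 - (i.1 : ℤ)) = -(-1) ^ i.1 * ζ ^ (1 - (i.1 : ℤ)) := by
    rw [neg_eq_neg_one_mul ζ, mul_zpow, zpow_sub₀ (by norm_num), zpow_one, zpow_natCast]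
    rcases neg_one_pow_eq_or ℂ i.1 with h | h <;> rw [h] <;> norm_num
  rw [val_neg, zpow_neg, neg_sq]
  push_cast
  rcases neg_one_pow_eq_or ℂ i.1 with h | h <;> rw [h] <;> ring

end Quadric

section Nevanlinna

variable {n : ℕ} {Y : HarmonicBasis n} {μ : SignedMeasure (Space n)} {C D : ℝ}

lemma half_le_norm_sub_of_mem_ball {z w a : ℂ} {ε : ℝ} (hw : w ∈ Metric.ball z (ε / 2))
    (h : ε ≤ ‖z - a‖) : ε / 2 ≤ ‖w - a‖ := by
  have dist_lt : dist w z < ε / 2 := hw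
  have triangle := dist_triangle_left z a w
  rw [← dist_eq_norm] at *
  linarith

lemma hasDerivAt_cauchy (a : ℂ) {b w : ℂ} (hw : w - b ≠ 0) :
    HasDerivAt (fun w : ℂ => a / (w - b)) (-(a / (w - b) ^ 2)) w := by
  refine ((hasDerivAt_const w a).fun_div ((hasDerivAt_id' w).sub_const b) hw).congr_deriv ?_
  ring

lemma differentiableAt_integral_cauchy {ν : Measure ℝ} {k : ℕ}
    (hk : Integrable (fun r : ℝ => r ^ k) ν) {z : ℂ} {ε : ℝ} (hε : 0 < ε)
    (h : ∀ᵐ r : ℝ ∂ν, ε ≤ ‖z - (r : ℂ) ^ 2‖) :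
    DifferentiableAt ℂ (fun w => ∫ r : ℝ, (r : ℂ) ^ k / (w - (r : ℂ) ^ 2) ∂ν) z := by
  refine (hasDerivAt_integral_of_dominated_loc_of_deriv_le (μ := ν)
    (F := fun (w : ℂ) (r : ℝ) => (r : ℂ) ^ k / (w - (r : ℂ) ^ 2))
    (F' := fun (w : ℂ) (r : ℝ) => -((r : ℂ) ^ k / (w - (r : ℂ) ^ 2) ^ 2))
    (bound := fun r => ‖r ^ k‖ / (ε / 2) ^ 2) (Metric.ball_mem_nhds z (half_pos hε))
    (.of_forall fun w => Measurable.aestronglyMeasurable (by fun_prop))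
    (integrable_cauchy hε h hk) (Measurable.aestronglyMeasurable (by fun_prop)) ?_
    (hk.norm.div_const _) ?_).2.differentiableAt
  · filter_upwards [h] with r hr w hw
    have le_norm := half_le_norm_sub_of_mem_ball hw hr
    rw [norm_neg, norm_div, norm_pow, norm_pow, Complex.norm_real, ← norm_pow]
    gcongr
  · filter_upwards [h] with r hr w hw
    exact hasDerivAt_cauchy _
      (norm_pos_iff.1 ((half_pos hε).trans_le (half_le_norm_sub_of_mem_ball hw hr)))

lemma IsPseudoPositive.analyticAt_componentTransform (hμ : IsPseudoPositive Y μ) {i : HIndex n}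
    (hk : Integrable (fun r : ℝ => r ^ i.1) (compMeasure Y μ i)) {z : ℂ} {ε : ℝ} (hε : 0 < ε)
    (h : ∀ᵐ r : ℝ ∂(compMeasure Y μ i), ε ≤ ‖z - (r : ℂ) ^ 2‖) :
    AnalyticAt ℂ (componentTransform Y μ i) z := by
  rw [funext (hμ.componentTransform_eq i)]
  refine DifferentiableOn.analyticAt (s := Metric.ball z (ε / 2)) (fun w hw => ?_)
    (Metric.ball_mem_nhds z (half_pos hε))
  exact (differentiableAt_integral_cauchy hk (half_pos hε)
    (h.mono fun _ => half_le_norm_sub_of_mem_ball hw)).differentiableWithinAt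

lemma im_le_norm_sub_sq (z : ℂ) (r : ℝ) : z.im ≤ ‖z - (r : ℂ) ^ 2‖ := by
  have im_eq : (z - (r : ℂ) ^ 2).im = z.im := by
    rw [← Complex.ofReal_pow, Complex.sub_im, Complex.ofReal_im, sub_zero]
  exact im_eq ▸ (le_abs_self _).trans (Complex.abs_im_le_norm _)

lemma im_neg_cauchy (z : ℂ) (k : ℕ) (r : ℝ) : (-((r : ℂ) ^ k / (z - (r : ℂ) ^ 2))).im =
    r ^ k * (z.im / Complex.normSq (z - (r : ℂ) ^ 2)) := by
  rw [div_eq_mul_inv, ← mul_neg, ← Complex.ofReal_pow, Complex.im_ofReal_mul, Complex.neg_im,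
    Complex.inv_im, ← Complex.ofReal_pow, Complex.sub_im, Complex.ofReal_im, sub_zero, neg_div,
    neg_neg]

lemma IsPseudoPositive.neg_componentTransform_mem_nevanlinnaClass (hμ : IsPseudoPositive Y μ)
    {i : HIndex n} (hk : Integrable (fun r : ℝ => r ^ i.1) (compMeasure Y μ i)) :
    (fun z => -componentTransform Y μ i z) ∈ nevanlinnaClass := by
  refine ⟨fun z hz => (hμ.analyticAt_componentTransform hk hz
    (.of_forall (im_le_norm_sub_sq z))).neg, fun z hz => ?_⟩
  have integrable := integrable_cauchy hz (.of_forall (im_le_norm_sub_sq z)) hk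
  beta_reduce
  rw [hμ.componentTransform_eq, ← integral_neg]
  refine (integral_nonneg_of_ae ?_).trans_eq
    (ContinuousLinearMap.integral_comp_comm Complex.imCLM integrable.neg)
  filter_upwards [ae_nonneg_compMeasure Y μ i] with r hr
  simp only [Pi.zero_apply, Complex.imCLM_apply, im_neg_cauchy]
  exact mul_nonneg (pow_nonneg hr _) (div_nonneg hz.le (Complex.normSq_nonneg _))

lemma MomentBound.summableUniformlyOn [NeZero n] (hM : MomentBound Y μ C D)
    (hμ : IsPseudoPositive Y μ) (hD : 0 ≤ D) {a ε : ℝ} (ha : D < a) (hε : 0 < ε)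
    {S : Set (ℂ × Sphere n)} (norm_ge : ∀ p ∈ S, a ≤ ‖p.1‖)
    (h : ∀ p ∈ S, IsSeparated Y μ ε (p.1 ^ 2)) :
    SummableUniformlyOn (fun (i : HIndex n) (p : ℂ × Sphere n) =>
      ‖-componentTransform Y μ i (p.1 ^ 2) * (1 / p.1 ^ i.1) * (Y.val i p.2 : ℂ)‖) S := by
  have a_pos : 0 < a := hD.trans_lt ha
  refine (HasSumUniformlyOn.of_norm_le_summable
    (summable_harmonicDim_sq_mul_div_pow Y hD ha (C / ε)) fun i p hp => ?_).summableUniformlyOn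
  have norm_le := (norm_integral_le_integral_norm _).trans
    (hM.integral_norm_cauchy_le i hε (h p hp))
  rw [norm_norm, norm_mul, norm_mul, norm_neg, norm_div, norm_one, norm_pow, Complex.norm_real,
    Real.norm_eq_abs, hμ.componentTransform_eq]
  calc _ ≤ C * harmonicDim n i.1 * D ^ i.1 / ε * (1 / a ^ i.1) * harmonicDim n i.1 := by
        have := (norm_nonneg _).trans norm_le
        gcongr
        · exact norm_ge p hp
        · exact abs_val_sphere_le Y i p.2
    _ = _ := by
        rw [div_pow]
        ring

theorem MomentBound.transformIsNevanlinna [NeZero n] (hM : MomentBound Y μ C D)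
    (hμ : IsPseudoPositive Y μ) (hD : 0 ≤ D) {Ω : Set (KDQ n)} {δ : ℂ → ℝ} (hδ : Continuous δ)
    (separated : ∀ z, IsSeparated Y μ (δ z) z)
    (hΩ : ∀ ζ θ, KDQ.mk ζ θ ∈ Ω → D < ‖ζ‖ ∧ 0 < δ (ζ ^ 2)) : TransformIsNevanlinna Y μ Ω := by
  refine ⟨KDQ.lift (fun ζ θ => -(ζ⁻¹ * transform Y μ ζ θ)) (fun ζ θ => ?_),
    ⟨fun i z => -componentTransform Y μ i z, ⟨fun i => ?_, fun ζ θ h => ?_, fun K hK hKΩ => ?_⟩,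
      fun i => hμ.neg_componentTransform_mem_nevanlinnaClass (hM i).1⟩, fun ζ θ _ => rfl⟩
  · rw [transform_neg, inv_neg]
    ring
  · rintro z ⟨ζ, θ, h, rfl⟩
    exact (hμ.analyticAt_componentTransform (hM i).1 (hΩ ζ θ h).2 (separated _ i)).neg
  · have hζ : ζ ≠ 0 := norm_pos_iff.1 (hD.trans_lt (hΩ ζ θ h).1)
    rw [KDQ.lift_mk]
    refine (((hM.hasSum_transform hμ hD (hΩ ζ θ h).1 (hΩ ζ θ h).2
      (separated _) θ).mul_left ζ⁻¹).neg).congr_fun fun i => ?_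
    rw [zpow_sub₀ hζ, zpow_one, zpow_natCast]
    field_simp
  · obtain ⟨a, ha, norm_ge⟩ := KDQ.exists_forall_le_of_isCompact continuous_norm norm_neg hK
      (a := D) fun ζ θ h => (hΩ ζ θ (hKΩ h)).1
    obtain ⟨ε, hε, δ_ge⟩ := KDQ.exists_forall_le_of_isCompact (hδ.comp (continuous_pow 2))
      (fun ζ => by simp) hK (a := 0) fun ζ θ h => (hΩ ζ θ (hKΩ h)).2
    exact hM.summableUniformlyOn hμ hD ha hε (fun p => norm_ge p.1 p.2)
      fun p hp i => (separated _ i).mono fun r => (δ_ge p.1 p.2 hp).trans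

lemma sq_norm_sub_sq_pos {R : ℝ} (hR : 0 ≤ R) {ζ : ℂ} (hζ : R < ‖ζ‖) : 0 < ‖ζ ^ 2‖ - R ^ 2 := by
  rw [norm_pow, sub_pos]
  gcongr

theorem IsPseudoPositive.transformConverges_truncation [NeZero n] (hμ : IsPseudoPositive Y μ)
    {R : ℝ} (hR : 0 ≤ R) {ζ : ℂ} (hζ : R < ‖ζ‖) (θ : Sphere n) :
    TransformConverges Y (truncation μ R) ζ θ :=
  (hμ.momentBound_truncation hR).transformConverges hR hζ (sq_norm_sub_sq_pos hR hζ)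
    (isSeparated_truncation Y μ R _) θ

theorem IsPseudoPositive.transformIsNevanlinna_truncation [NeZero n] (hμ : IsPseudoPositive Y μ)
    {R : ℝ} (hR : 0 < R) : TransformIsNevanlinna Y (truncation μ R) (KDQ.exterior n R) :=
  (hμ.momentBound_truncation hR.le).transformIsNevanlinna (hμ.truncation R) hR.le
    (δ := fun z => ‖z‖ - R ^ 2) (by fun_prop) (isSeparated_truncation Y μ R)
    fun _ _ h => have norm_lt := KDQ.lt_norm_of_mem_exterior hR h
      ⟨norm_lt, sq_norm_sub_sq_pos hR.le norm_lt⟩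

/-- The distance of a complex number from the half-line `[0, ∞)`. -/
def rayDist (z : ℂ) : ℝ := Metric.infDist z ((fun t : ℝ => (t : ℂ)) '' Set.Ici 0)

lemma isSeparated_rayDist (Y : HarmonicBasis n) (μ : SignedMeasure (Space n)) (z : ℂ) :
    IsSeparated Y μ (rayDist z) z := fun i => .of_forall fun r => by
  rw [← dist_eq_norm]
  exact Metric.infDist_le_dist_of_mem ⟨r ^ 2, sq_nonneg r, by push_cast; rfl⟩

lemma rayDist_pos {z : ℂ} (hz : ∀ t : ℝ, 0 ≤ t → z ≠ (t : ℂ)) : 0 < rayDist z := by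
  have isClosed_ray : IsClosed ((fun t : ℝ => (t : ℂ)) '' Set.Ici 0) :=
    Complex.isometry_ofReal.isClosedEmbedding.isClosedMap _ isClosed_Ici
  refine (isClosed_ray.notMem_iff_infDist_pos ⟨0, 0, by simp, by simp⟩).1 ?_
  rintro ⟨t, ht, rfl⟩
  exact hz t ht rfl

theorem MomentBound.transformIsNevanlinna_slit [NeZero n] (hM : MomentBound Y μ C D)
    (hμ : IsPseudoPositive Y μ) (hD : 0 < D) :
    TransformIsNevanlinna Y μ (KDQ.exterior n D ∩ KDQ.slit n) :=
  hM.transformIsNevanlinna hμ hD.le (Metric.continuous_infDist_pt _) (isSeparated_rayDist Y μ)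
    fun _ _ h => ⟨KDQ.lt_norm_of_mem_exterior hD h.1, rayDist_pos (KDQ.sq_ne_of_mem_slit h.2)⟩

end Nevanlinna

section KernelIntegral

variable {n : ℕ}

lemma measurable_kernel (ζ : ℂ) (θ : Sphere n) : Measurable (kernel ζ θ) := by
  unfold kernel distRoot
  fun_prop

lemma measurable_kernelTerm (Y : HarmonicBasis n) (ζ : ℂ) (θ : Sphere n) (i : HIndex n) :
    Measurable (kernelTerm Y ζ θ i) := by
  have := Y.measurable_angular i
  unfold kernelTerm
  fun_prop

lemma ae_norm_le_variation_truncation (μ : SignedMeasure (Space n)) (R : ℝ) :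
    ∀ᵐ x ∂(truncation μ R).variation, ‖x‖ ≤ R := by
  rw [truncation, VectorMeasure.variation_restrict measurableSet_closedBall]
  filter_upwards [ae_restrict_mem measurableSet_closedBall] with x hx
  exact mem_closedBall_zero_iff.1 hx

theorem integrable_kernel_truncation [NeZero n] (Y : HarmonicBasis n)
    (μ : SignedMeasure (Space n)) {R : ℝ} (hR : 0 ≤ R) {ζ : ℂ} (hζ : R < ‖ζ‖) (θ : Sphere n) :
    (truncation μ R).Integrable (kernel ζ θ) := by
  refine Integrable.of_bound (measurable_kernel ζ θ).aestronglyMeasurable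
    (∑' i : HIndex n, (‖ζ‖ / (‖ζ‖ ^ 2 - R ^ 2)) *
      ((harmonicDim n i.1 : ℝ) ^ 2 * (R / ‖ζ‖) ^ i.1)) ?_
  filter_upwards [ae_norm_le_variation_truncation μ R] with x hx
  rw [← (hasSum_kernelTerm Y θ (hx.trans_lt hζ)).tsum_eq]
  exact tsum_of_norm_bounded (summable_harmonicDim_sq_mul_div_pow Y hR hζ _).hasSum
    (norm_kernelTerm_le Y θ hx hζ)

lemma IsPseudoPositive.integral_kernelTerm [NeZero n] {Y : HarmonicBasis n}
    {μ : SignedMeasure (Space n)} (hμ : IsPseudoPositive Y μ) {ζ : ℂ} {θ : Sphere n} {i : HIndex n}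
    (h : μ.Integrable (kernelTerm Y ζ θ i)) :
    ∫ᵛ x, kernelTerm Y ζ θ i x ∂<•μ =
      ζ ^ (1 - (i.1 : ℤ)) * (Y.val i θ : ℂ) * componentTransform Y μ i (ζ ^ 2) := by
  let f (r : ℝ) : ℂ := ζ ^ (1 - (i.1 : ℤ)) * (Y.val i θ : ℂ) *
    ((r : ℂ) ^ i.1 / (ζ ^ 2 - (r : ℂ) ^ 2))
  have measurable_f : Measurable f := by fun_prop
  have kernelTerm_eq : kernelTerm Y ζ θ i = fun x => Y.angular i x • f ‖x‖ := by
    ext x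
    rw [Complex.real_smul, kernelTerm]
    ring
  rw [kernelTerm_eq] at h ⊢
  rw [hμ.componentTransform_eq, ← integral_const_mul]
  exact (hμ.integral_compMeasure i measurable_f.stronglyMeasurable h).symm

theorem IsPseudoPositive.transform_truncation_eq [NeZero n] {Y : HarmonicBasis n}
    {μ : SignedMeasure (Space n)} (hμ : IsPseudoPositive Y μ) {R : ℝ} (hR : 0 ≤ R) {ζ : ℂ}
    (hζ : R < ‖ζ‖) (θ : Sphere n) :
    transform Y (truncation μ R) ζ θ = ∫ᵛ x, kernel ζ θ x ∂<•(truncation μ R) := by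
  have norm_le := ae_norm_le_variation_truncation μ R
  have norm_kernelTerm_le (i : HIndex n) := norm_le.mono fun x hx => norm_kernelTerm_le Y θ hx hζ i
  have aestronglyMeasurable (i : HIndex n) :=
    (measurable_kernelTerm Y ζ θ i).aestronglyMeasurable (μ := (truncation μ R).variation)
  have hasSum_integral : HasSum (fun i => ∫ᵛ x, kernelTerm Y ζ θ i x ∂<•(truncation μ R))
      (∫ᵛ x, kernel ζ θ x ∂<•(truncation μ R)) :=
    VectorMeasure.hasSum_integral_of_dominated_convergence
      (fun i _ => (‖ζ‖ / (‖ζ‖ ^ 2 - R ^ 2)) * ((harmonicDim n i.1 : ℝ) ^ 2 * (R / ‖ζ‖) ^ i.1))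
      aestronglyMeasurable norm_kernelTerm_le
      (.of_forall fun _ => summable_harmonicDim_sq_mul_div_pow Y hR hζ _) (integrable_const _)
      (norm_le.mono fun x hx => hasSum_kernelTerm Y θ (hx.trans_lt hζ))
  rw [← hasSum_integral.tsum_eq, transform]
  exact tsum_congr fun i => ((hμ.truncation R).integral_kernelTerm
    (.of_bound (aestronglyMeasurable i) _ (norm_kernelTerm_le i))).symm

end KernelIntegral

section Asymptotics

lemma integral_cauchy_recursion {ν : Measure ℝ} {z : ℂ} {ε : ℝ} (hε : 0 < ε) {m : ℕ}
    (h : ∀ᵐ r : ℝ ∂ν, ε ≤ ‖z - (r : ℂ) ^ 2‖) (hm : Integrable (fun r : ℝ => r ^ m) ν) :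
    z * ∫ r : ℝ, (r : ℂ) ^ m / (z - (r : ℂ) ^ 2) ∂ν =
      ((∫ r, r ^ m ∂ν : ℝ) : ℂ) + ∫ r : ℝ, (r : ℂ) ^ (m + 2) / (z - (r : ℂ) ^ 2) ∂ν := by
  have integrable_pow : Integrable (fun r : ℝ => (r : ℂ) ^ m) ν := by
    simpa using hm.ofReal (𝕜 := ℂ)
  have cauchy_eq : ∀ᵐ r : ℝ ∂ν, (r : ℂ) ^ (m + 2) / (z - (r : ℂ) ^ 2) =
      z * ((r : ℂ) ^ m / (z - (r : ℂ) ^ 2)) - (r : ℂ) ^ m := by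
    filter_upwards [h] with r hr
    have denom_ne_zero : z - (r : ℂ) ^ 2 ≠ 0 := norm_pos_iff.1 (hε.trans_le hr)
    field_simp
    ring
  rw [integral_congr_ae cauchy_eq, integral_sub ((integrable_cauchy hε h hm).const_mul z)
    integrable_pow, integral_const_mul, ← integral_complex_ofReal]
  push_cast
  ring

lemma integral_cauchy_sub_sum {ν : Measure ℝ} {z : ℂ} {ε : ℝ} (hε : 0 < ε) {k : ℕ}
    (h : ∀ᵐ r : ℝ ∂ν, ε ≤ ‖z - (r : ℂ) ^ 2‖) (hz : z ≠ 0) (M : ℕ)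
    (hM : ∀ j < M, Integrable (fun r : ℝ => r ^ (k + 2 * j)) ν) :
    z ^ M * ((∫ r : ℝ, (r : ℂ) ^ k / (z - (r : ℂ) ^ 2) ∂ν) -
      ∑ j ∈ Finset.range M, ((∫ r, r ^ (k + 2 * j) ∂ν : ℝ) : ℂ) / z ^ (j + 1)) =
      ∫ r : ℝ, (r : ℂ) ^ (k + 2 * M) / (z - (r : ℂ) ^ 2) ∂ν := by
  induction M with
  | zero => simp
  | succ M ih =>
    have recursion := integral_cauchy_recursion hε h (hM M M.lt_succ_self)
    rw [← ih fun j hj => hM j (hj.trans M.lt_succ_self)] at recursion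
    rw [show k + 2 * (M + 1) = k + 2 * M + 2 by ring, ← sub_eq_iff_eq_add'.2 recursion,
      Finset.sum_range_succ]
    field_simp
    ring

variable {n : ℕ}

lemma HarmonicBasis.continuous_val_sphere (Y : HarmonicBasis n) (i : HIndex n) :
    Continuous fun θ : Sphere n => Y.val i θ :=
  (Y.continuous_val i).comp continuous_subtype_val

lemma HarmonicBasis.integral_val_mul_val (Y : HarmonicBasis n) (i j : HIndex n) :
    ∫ θ : Sphere n, ((Y.val i θ : ℂ) * (Y.val j θ : ℂ)) ∂(sphereMeasure n) =
      if i = j then 1 else 0 := by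
  have orthonormal := congrArg (fun r : ℝ => (r : ℂ)) (Y.orthonormal i j)
  simp only [← integral_complex_ofReal] at orthonormal
  push_cast at orthonormal
  exact orthonormal.trans (by split_ifs <;> simp)

variable {Y : HarmonicBasis n} {μ : SignedMeasure (Space n)} {C D : ℝ}

namespace MomentBound

variable [NeZero n] {ζ : ℂ} {ε : ℝ}

lemma continuous_transform (hM : MomentBound Y μ C D) (hμ : IsPseudoPositive Y μ) (hD : 0 ≤ D)
    (hζ : D < ‖ζ‖) (hε : 0 < ε) (h : IsSeparated Y μ ε (ζ ^ 2)) :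
    Continuous (transform Y μ ζ) := by
  refine continuous_tsum (fun i => ?_) (summable_harmonicDim_sq_mul_div_pow Y hD hζ _) fun i θ =>
    hM.norm_transform_summand_le hμ i (norm_pos_iff.1 (hD.trans_lt hζ)) hε h θ
  have := Y.continuous_val_sphere i
  fun_prop

theorem integrable_transform_mul_val (hM : MomentBound Y μ C D) (hμ : IsPseudoPositive Y μ)
    (hD : 0 ≤ D) (hζ : D < ‖ζ‖) (hε : 0 < ε) (h : IsSeparated Y μ ε (ζ ^ 2)) (j : HIndex n) :
    Integrable (fun θ : Sphere n => transform Y μ ζ θ * (Y.val j θ : ℂ)) (sphereMeasure n) :=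
  integrable_sphere ((hM.continuous_transform hμ hD hζ hε h).mul
    (Complex.continuous_ofReal.comp (Y.continuous_val_sphere j)))

lemma hasSum_harmonicCoefficient (hM : MomentBound Y μ C D) (hμ : IsPseudoPositive Y μ)
    (hD : 0 ≤ D) (hζ : D < ‖ζ‖) (hε : 0 < ε) (h : IsSeparated Y μ ε (ζ ^ 2)) (j : HIndex n) :
    HasSum (fun i : HIndex n => ζ ^ (1 - (i.1 : ℤ)) * componentTransform Y μ i (ζ ^ 2) *
      if i = j then 1 else 0) (harmonicCoefficient Y μ j ζ) := by
  refine (hasSum_integral_of_dominated_convergence (μ := sphereMeasure n)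
    (F := fun (i : HIndex n) (θ : Sphere n) => ζ ^ (1 - (i.1 : ℤ)) * (Y.val i θ : ℂ) *
      componentTransform Y μ i (ζ ^ 2) * (Y.val j θ : ℂ))
    (fun i _ => ‖ζ‖ * C / ε * ((harmonicDim n i.1 : ℝ) ^ 2 * (D / ‖ζ‖) ^ i.1) *
      harmonicDim n j.1)
    (fun i => ?_) (fun i => .of_forall fun θ => ?_)
    (.of_forall fun _ => (summable_harmonicDim_sq_mul_div_pow Y hD hζ _).mul_right _)
    (integrable_const _)
    (.of_forall fun θ => (hM.hasSum_transform hμ hD hζ hε h θ).mul_right _)).congr_fun fun i => ?_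
  · have := Y.continuous_val_sphere
    exact Continuous.aestronglyMeasurable (by fun_prop)
  · rw [norm_mul, Complex.norm_real, Real.norm_eq_abs]
    have summand_le :=
      hM.norm_transform_summand_le hμ i (norm_pos_iff.1 (hD.trans_lt hζ)) hε h θ
    exact mul_le_mul summand_le (abs_val_sphere_le Y j θ) (abs_nonneg _)
      ((norm_nonneg _).trans summand_le)
  · simp only [← Y.integral_val_mul_val, ← integral_const_mul]
    congr 1 with θ
    ring

theorem harmonicCoefficient_eq (hM : MomentBound Y μ C D) (hμ : IsPseudoPositive Y μ)
    (hD : 0 ≤ D) (hζ : D < ‖ζ‖) (hε : 0 < ε) (h : IsSeparated Y μ ε (ζ ^ 2)) (j : HIndex n) :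
    harmonicCoefficient Y μ j ζ = ζ ^ (1 - (j.1 : ℤ)) * componentTransform Y μ j (ζ ^ 2) := by
  simpa using (hM.hasSum_harmonicCoefficient hμ hD hζ hε h j).tsum_eq.symm

end MomentBound

lemma sum_div_pow_odd (s : ℕ → ℂ) {ζ : ℂ} (hζ : ζ ≠ 0) (k M : ℕ) :
    ∑ j ∈ Finset.range M, s j / ζ ^ (k + 2 * j + 1) =
      ζ / ζ ^ k * ∑ j ∈ Finset.range M, s j / (ζ ^ 2) ^ (j + 1) := by
  rw [Finset.mul_sum]
  refine Finset.sum_congr rfl fun j _ => ?_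
  field_simp
  ring

variable {s : HIndex n → ℕ → ℝ} {J : ℕ}

theorem SolvesMomentProblem.scaledRemainder_sub [NeZero n] (hs : SolvesMomentProblem Y μ s J)
    (hμ : IsPseudoPositive Y μ) (hC : 0 ≤ C) (hD : 0 ≤ D) (hg : GrowthBound s C D) {ζ : ℂ}
    (hζ : D < ‖ζ‖) (hslit : ∀ t : ℝ, 0 ≤ t → ζ ^ 2 ≠ (t : ℂ)) (i : HIndex n) {M : ℕ}
    (hMJ : M ≤ J) :
    scaledRemainder Y μ s M i ζ - (s i M : ℂ) =
      ∫ r : ℝ, (r : ℂ) ^ (i.1 + 2 * (M + 1)) / (ζ ^ 2 - (r : ℂ) ^ 2) ∂(compMeasure Y μ i) := by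
  have hζ0 : ζ ≠ 0 := norm_pos_iff.1 (hD.trans_lt hζ)
  have separated := isSeparated_rayDist Y μ (ζ ^ 2)
  have sum_moments_eq : ∑ j ∈ Finset.range M,
      ((∫ r, r ^ (i.1 + 2 * j) ∂(compMeasure Y μ i) : ℝ) : ℂ) / (ζ ^ 2) ^ (j + 1) =
      ∑ j ∈ Finset.range M, (s i j : ℂ) / (ζ ^ 2) ^ (j + 1) := Finset.sum_congr rfl fun j hj => by
    rw [hs.integral_pow hμ i ((Finset.mem_range.1 hj).le.trans hMJ)]
  rw [← integral_cauchy_sub_sum (rayDist_pos hslit) (separated i) (pow_ne_zero 2 hζ0) (M + 1)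
      fun j hj => hs.integrable_pow i ((Nat.lt_succ_iff.1 hj).trans hMJ),
    scaledRemainder, (hs.momentBound hμ hC hD hg).harmonicCoefficient_eq hμ hD hζ
      (rayDist_pos hslit) separated, hμ.componentTransform_eq, zpow_sub₀ hζ0, zpow_one,
    zpow_natCast, sum_div_pow_odd _ hζ0, Finset.sum_range_succ, hs.integral_pow hμ i hMJ,
    sum_moments_eq]
  field_simp
  ring

lemma sin_mul_max_le_norm_sub {δ : ℝ} (hδ : 0 ≤ δ) {z : ℂ} (hz : δ ≤ z.arg) {t : ℝ}
    (ht : 0 ≤ t) : Real.sin δ * max ‖z‖ t ≤ ‖z - (t : ℂ)‖ := by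
  have re_le : z.re ≤ ‖z‖ * Real.cos δ := by
    rw [← Complex.norm_mul_cos_arg z]
    exact mul_le_mul_of_nonneg_left
      (Real.cos_le_cos_of_nonneg_of_le_pi hδ (Complex.arg_le_pi z) hz) (norm_nonneg z)
  have norm_sq_eq : ‖z - (t : ℂ)‖ ^ 2 = ‖z‖ ^ 2 - 2 * t * z.re + t ^ 2 := by
    rw [Complex.sq_norm, Complex.sq_norm, Complex.normSq_apply, Complex.normSq_apply]
    simp only [Complex.sub_re, Complex.sub_im, Complex.ofReal_re, Complex.ofReal_im]
    ring
  have le_norm_sq : ‖z‖ ^ 2 - 2 * t * (‖z‖ * Real.cos δ) + t ^ 2 ≤ ‖z - (t : ℂ)‖ ^ 2 := by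
    rw [norm_sq_eq]
    gcongr
  refine abs_le_of_sq_le_sq' ?_ (norm_nonneg _) |>.2
  refine le_trans ?_ le_norm_sq
  rcases max_choice ‖z‖ t with h | h <;> rw [h, mul_pow, Real.sin_sq]
  · nlinarith [sq_nonneg (t - ‖z‖ * Real.cos δ)]
  · nlinarith [sq_nonneg (‖z‖ - t * Real.cos δ)]

lemma sq_ne_of_mem_sector {δ : ℝ} (hδ : 0 < δ) {ζ : ℂ} (hζ : ζ ∈ sector δ) (t : ℝ)
    (ht : 0 ≤ t) : ζ ^ 2 ≠ (t : ℂ) := fun h => by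
  have le_arg := hζ.1
  rw [h, Complex.arg_ofReal_of_nonneg ht] at le_arg
  exact le_arg.not_gt hδ

lemma norm_pow_mul_sq_div_max_le (T : ℝ) (m : ℕ) (r : ℝ) :
    ‖r ^ m * (r ^ 2 / max T (r ^ 2))‖ ≤ ‖r ^ m‖ := by
  have max_nonneg : 0 ≤ max T (r ^ 2) := le_max_of_le_right (sq_nonneg r)
  rw [norm_mul, Real.norm_of_nonneg (div_nonneg (sq_nonneg r) max_nonneg)]
  exact mul_le_of_le_one_right (norm_nonneg _) (div_le_one_of_le₀ (le_max_right _ _) max_nonneg)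

lemma tendsto_integral_pow_mul_sq_div_max {ν : Measure ℝ} {m : ℕ}
    (hm : Integrable (fun r : ℝ => r ^ m) ν) :
    Tendsto (fun T : ℝ => ∫ r, r ^ m * (r ^ 2 / max T (r ^ 2)) ∂ν) atTop (𝓝 0) := by
  have tendsto_integrand (r : ℝ) :
      Tendsto (fun T : ℝ => r ^ m * (r ^ 2 / max T (r ^ 2))) atTop (𝓝 0) := by
    rw [← mul_zero (r ^ m)]
    exact ((tendsto_const_nhds (x := r ^ 2)).div_atTop
      (tendsto_atTop_mono (fun T => le_max_left T (r ^ 2)) tendsto_id)).const_mul _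
  simpa using tendsto_integral_filter_of_dominated_convergence (fun r => ‖r ^ m‖)
    (.of_forall fun T => Measurable.aestronglyMeasurable (by fun_prop))
    (.of_forall fun T => .of_forall (norm_pow_mul_sq_div_max_le T m)) hm.norm
    (.of_forall tendsto_integrand)

lemma norm_integral_cauchy_le_of_le_arg {ν : Measure ℝ} (hν : ∀ᵐ r : ℝ ∂ν, 0 ≤ r) {m : ℕ}
    (hm : Integrable (fun r : ℝ => r ^ m) ν) {δ : ℝ} (hδ : 0 < δ) (hδ' : δ < Real.pi) {z : ℂ}
    (hz : δ ≤ z.arg) :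
    ‖∫ r : ℝ, (r : ℂ) ^ (m + 2) / (z - (r : ℂ) ^ 2) ∂ν‖ ≤
      (Real.sin δ)⁻¹ * ∫ r, r ^ m * (r ^ 2 / max ‖z‖ (r ^ 2)) ∂ν := by
  have sin_pos : 0 < Real.sin δ := Real.sin_pos_of_pos_of_lt_pi hδ hδ'
  have z_ne_zero : z ≠ 0 := by
    rintro rfl
    exact (hδ.trans_le hz).ne' Complex.arg_zero
  rw [← integral_const_mul]
  refine norm_integral_le_of_norm_le (.const_mul (hm.mono (Measurable.aestronglyMeasurable
    (by fun_prop)) (.of_forall (norm_pow_mul_sq_div_max_le _ m))) _) ?_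
  filter_upwards [hν] with r hr
  have le_norm_sub := sin_mul_max_le_norm_sub hδ.le hz (sq_nonneg r)
  push_cast at le_norm_sub
  have : 0 < max ‖z‖ (r ^ 2) := lt_max_of_lt_left (norm_pos_iff.2 z_ne_zero)
  rw [norm_div, norm_pow, Complex.norm_real, Real.norm_of_nonneg hr]
  calc r ^ (m + 2) / ‖z - (r : ℂ) ^ 2‖ ≤ r ^ (m + 2) / (Real.sin δ * max ‖z‖ (r ^ 2)) := by gcongr
    _ = _ := by
        rw [pow_add]
        field_simp

theorem SolvesMomentProblem.exists_norm_scaledRemainder_sub_lt [NeZero n]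
    (hs : SolvesMomentProblem Y μ s J) (hμ : IsPseudoPositive Y μ) (hC : 0 ≤ C) (hD : 0 ≤ D)
    (hg : GrowthBound s C D) (i : HIndex n) {M : ℕ} (hMJ : M ≤ J) {δ : ℝ} (hδ : 0 < δ)
    (hδ' : δ < Real.pi) {ε : ℝ} (hε : 0 < ε) :
    ∃ ρ : ℝ, ∀ ζ ∈ sector δ, ρ < ‖ζ‖ → ‖scaledRemainder Y μ s M i ζ - (s i M : ℂ)‖ < ε := by
  have sin_pos : 0 < Real.sin δ := Real.sin_pos_of_pos_of_lt_pi hδ hδ'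
  have integrable_moment := hs.integrable_pow i hMJ
  obtain ⟨T, hT⟩ := eventually_atTop.1 ((tendsto_integral_pow_mul_sq_div_max
    integrable_moment).eventually_lt_const (mul_pos sin_pos hε))
  refine ⟨max D (max 1 T), fun ζ hζ norm_gt => ?_⟩
  obtain ⟨hζD, one_lt, hTζ⟩ : D < ‖ζ‖ ∧ 1 < ‖ζ‖ ∧ T < ‖ζ‖ := by simpa using norm_gt
  have T_le : T ≤ ‖ζ ^ 2‖ := by
    rw [norm_pow]
    exact hTζ.le.trans (le_self_pow₀ one_lt.le two_ne_zero)
  rw [hs.scaledRemainder_sub hμ hC hD hg hζD (sq_ne_of_mem_sector hδ hζ) i hMJ,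
    show i.1 + 2 * (M + 1) = i.1 + 2 * M + 2 by ring]
  refine (norm_integral_cauchy_le_of_le_arg (ae_nonneg_compMeasure Y μ i) integrable_moment hδ hδ'
    hζ.1).trans_lt ?_
  rw [inv_mul_lt_iff₀ sin_pos]
  exact hT _ T_le

end Asymptotics

section Dimension

variable {n : ℕ}

lemma zonalRatio_pos (hn : 2 ≤ n) (k : ℕ) : 0 < zonalRatio n k := by
  have two_le : (2 : ℝ) ≤ n := by exact_mod_cast hn
  rcases k with _ | k
  · exact one_pos
  · have num_pos : (0 : ℝ) < k + n - 1 := by linarith [Nat.cast_nonneg (α := ℝ) k]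
    exact div_pos num_pos (by positivity)

lemma zonal_ne_zero (hn : 2 ≤ n) {η : Fin n → ℝ} (hη : ∑ i, η i ^ 2 = 1) (k : ℕ) :
    zonal η k ≠ 0 := by
  have : NeZero n := ⟨by omega⟩
  induction k with
  | zero => exact one_ne_zero
  | succ k ih =>
    intro zonal_eq
    have dirDeriv_eq := dirDeriv_zonal_succ hη k
    rw [zonal_eq, map_zero, eq_comm, mul_eq_zero, MvPolynomial.C_eq_zero] at dirDeriv_eq
    exact dirDeriv_eq.elim (mul_pos k.cast_add_one_pos (zonalRatio_pos hn k)).ne' ih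

theorem harmonicDim_pos (hn : 2 ≤ n) (Y : HarmonicBasis n) (k : ℕ) : 0 < harmonicDim n k := by
  have : NeZero n := ⟨by omega⟩
  have := Module.Finite.of_basis (Y.basis k)
  obtain ⟨η⟩ : Nonempty (Sphere n) := (NormedSpace.sphere_nonempty.2 zero_le_one).to_subtype
  refine Nat.pos_of_ne_zero fun finrank_eq => zonal_ne_zero hn (sum_sq_sphere η) k ?_
  have zonal_mem := zonal_mem_solidHarmonics (fun i => (η : Space n) i) k
  rwa [Submodule.finrank_eq_zero.1 finrank_eq, Submodule.mem_bot] at zonal_mem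

end Dimension

section Shells

variable {n : ℕ}

/-- Radii growing so fast that the measure `shellMeasure` on the union of the spheres with these
radii is finite. -/
def shellRadius (n k : ℕ) : ℝ := 2 ^ k * (1 + (harmonicDim n k : ℝ) ^ 2)

lemma two_pow_le_shellRadius (n k : ℕ) : 2 ^ k ≤ shellRadius n k :=
  le_mul_of_one_le_right (by positivity) (le_add_of_nonneg_right (sq_nonneg _))

lemma one_le_shellRadius (n k : ℕ) : 1 ≤ shellRadius n k :=
  (one_le_pow₀ one_le_two).trans (two_pow_le_shellRadius n k)

lemma shellRadius_pos (n k : ℕ) : 0 < shellRadius n k := one_pos.trans_le (one_le_shellRadius n k)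

/-- A uniform bound for `shellDensity` on the `k`-th sphere. -/
def shellWeight (n k : ℕ) : ℝ := (shellRadius n k ^ k)⁻¹ * (harmonicDim n k : ℝ) ^ 2

lemma shellWeight_nonneg (n k : ℕ) : 0 ≤ shellWeight n k := by
  have := shellRadius_pos n k
  unfold shellWeight
  positivity

lemma summable_shellWeight_mul_pow (n m : ℕ) :
    Summable fun k => shellWeight n k * shellRadius n k ^ m := by
  refine .of_norm_bounded_eventually_nat (g := fun k => (1 / 2 : ℝ) ^ k) summable_geometric_two ?_
  filter_upwards [eventually_ge_atTop (m + 1)] with k hk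
  have radius_pos := shellRadius_pos n k
  have dim_sq_le : (harmonicDim n k : ℝ) ^ 2 ≤ (1 / 2) ^ k * shellRadius n k := by
    rw [shellRadius, ← mul_assoc, ← mul_pow]
    norm_num
  rw [Real.norm_of_nonneg (mul_nonneg (shellWeight_nonneg n k) (by positivity))]
  calc shellWeight n k * shellRadius n k ^ m
      ≤ (shellRadius n k ^ (m + 1))⁻¹ * (harmonicDim n k : ℝ) ^ 2 * shellRadius n k ^ m := by
        unfold shellWeight
        gcongr
        exact one_le_shellRadius n k
    _ = (harmonicDim n k : ℝ) ^ 2 / shellRadius n k := by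
        rw [pow_succ]
        field_simp
    _ ≤ (1 / 2) ^ k := (div_le_iff₀ radius_pos).2 dim_sq_le

/-- The density of `shellMeasure` on the `k`-th sphere. -/
def shellDensity (Y : HarmonicBasis n) (p : ℕ × Sphere n) : ℝ :=
  (shellRadius n p.1 ^ p.1)⁻¹ * ∑ l, Y.val ⟨p.1, l⟩ p.2

/-- The point of the `k`-th sphere in the direction `θ`. -/
def shellPoint (p : ℕ × Sphere n) : Space n := shellRadius n p.1 • (p.2 : Space n)

/-- The measure of the counterexample, in which no error term is uniformly small in `(k, ℓ)`: its
component `(k, ℓ)` is the mass `r⁻ᵏ` at the radius `r` of the `k`-th sphere. -/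
def shellMeasure (Y : HarmonicBasis n) : SignedMeasure (Space n) :=
  (((Measure.count : Measure ℕ).prod (sphereMeasure n)).withDensityᵥ (shellDensity Y)).map
    shellPoint

lemma measurable_shellDensity (Y : HarmonicBasis n) : Measurable (shellDensity Y) := by
  refine measurable_from_prod_countable_right fun k => ?_
  have measurable_sum : Measurable fun θ : Sphere n => ∑ l, Y.val ⟨k, l⟩ θ :=
    Finset.measurable_fun_sum _ fun l _ => (Y.continuous_val_sphere ⟨k, l⟩).measurable
  exact measurable_sum.const_mul (shellRadius n k ^ k)⁻¹

lemma measurable_shellPoint : Measurable (shellPoint (n := n)) := by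
  have : Measurable (shellRadius n) := measurable_from_nat
  unfold shellPoint
  fun_prop

lemma norm_shellPoint (p : ℕ × Sphere n) : ‖shellPoint p‖ = shellRadius n p.1 := by
  rw [shellPoint, norm_smul, norm_eq_of_mem_sphere, mul_one,
    Real.norm_of_nonneg (shellRadius_pos n _).le]

lemma angular_shellPoint (Y : HarmonicBasis n) (j : HIndex n) (p : ℕ × Sphere n) :
    Y.angular j (shellPoint p) = Y.val j p.2 :=
  Y.angular_smul_sphere j p.2 (shellRadius_pos n p.1)

lemma abs_shellDensity_le [NeZero n] (Y : HarmonicBasis n) (p : ℕ × Sphere n) :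
    |shellDensity Y p| ≤ shellWeight n p.1 := by
  have := shellRadius_pos n p.1
  rw [shellDensity, shellWeight, abs_mul, abs_of_pos (by positivity)]
  gcongr
  calc |∑ l, Y.val ⟨p.1, l⟩ p.2| ≤ ∑ l, |Y.val ⟨p.1, l⟩ p.2| := Finset.abs_sum_le_sum_abs _ _
    _ ≤ Finset.card Finset.univ • (harmonicDim n p.1 : ℝ) :=
        Finset.sum_le_card_nsmul _ _ _ fun l _ => abs_val_sphere_le Y ⟨p.1, l⟩ p.2
    _ = (harmonicDim n p.1 : ℝ) ^ 2 := by simp [sq]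

lemma integrable_shellDensity_mul [NeZero n] (Y : HarmonicBasis n) {f : ℕ → ℝ}
    (hf : Summable fun k => shellWeight n k * |f k|) {g : Sphere n → ℝ} (hg : Measurable g)
    {c : ℝ} (hc : ∀ θ, |g θ| ≤ c) :
    Integrable (fun p : ℕ × Sphere n => shellDensity Y p • (g p.2 • f p.1))
      ((Measure.count : Measure ℕ).prod (sphereMeasure n)) := by
  have integrable_weight : Integrable (fun k => shellWeight n k * |f k|)
      (Measure.count : Measure ℕ) := integrable_count_iff.2 hf.norm
  refine ((integrable_weight.comp_fst (sphereMeasure n)).const_mul c).mono' ?_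
    (.of_forall fun p => ?_)
  · have := measurable_shellDensity Y
    have : Measurable f := measurable_from_nat
    exact Measurable.aestronglyMeasurable (by fun_prop)
  · rw [norm_smul, norm_smul, Real.norm_eq_abs, Real.norm_eq_abs, Real.norm_eq_abs]
    calc |shellDensity Y p| * (|g p.2| * |f p.1|) ≤ shellWeight n p.1 * (c * |f p.1|) := by
          gcongr
          · exact shellWeight_nonneg n p.1
          · exact abs_shellDensity_le Y p
          · exact hc p.2
      _ = _ := by ring

lemma integral_shellDensity_mul_val [NeZero n] (Y : HarmonicBasis n) (k : ℕ) (j : HIndex n) :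
    ∫ θ : Sphere n, shellDensity Y (k, θ) * Y.val j θ ∂(sphereMeasure n) =
      if k = j.1 then (shellRadius n k ^ k)⁻¹ else 0 := by
  have integral_val_mul (l : Fin (harmonicDim n k)) :
      ∫ θ : Sphere n, Y.val ⟨k, l⟩ θ * Y.val j θ ∂(sphereMeasure n) =
        if (⟨k, l⟩ : HIndex n) = j then 1 else 0 := Y.orthonormal ⟨k, l⟩ j
  have integrable_val_mul (l : Fin (harmonicDim n k)) :
      Integrable (fun θ : Sphere n => Y.val ⟨k, l⟩ θ * Y.val j θ) (sphereMeasure n) :=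
    integrable_sphere ((Y.continuous_val_sphere ⟨k, l⟩).mul (Y.continuous_val_sphere j))
  have shellDensity_mul (θ : Sphere n) : shellDensity Y (k, θ) * Y.val j θ =
      (shellRadius n k ^ k)⁻¹ * ∑ l, Y.val ⟨k, l⟩ θ * Y.val j θ := by
    rw [← Finset.sum_mul, ← mul_assoc, shellDensity]
  simp only [shellDensity_mul]
  rw [integral_const_mul, integral_finsetSum _ fun l _ => integrable_val_mul l]
  obtain ⟨k', l'⟩ := j
  simp only [integral_val_mul]
  split_ifs with hk
  · obtain rfl : k = k' := hk
    simp
  · have ne (l) : (⟨k, l⟩ : HIndex n) ≠ ⟨k', l'⟩ := fun h => hk (congrArg Sigma.fst h)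
    simp [ne]

lemma integral_shellDensity_mul [NeZero n] (Y : HarmonicBasis n) {f : ℕ → ℝ}
    (hf : Summable fun k => shellWeight n k * |f k|) (j : HIndex n) :
    ∫ p, shellDensity Y p • (Y.val j p.2 • f p.1)
      ∂((Measure.count : Measure ℕ).prod (sphereMeasure n)) =
      (shellRadius n j.1 ^ j.1)⁻¹ * f j.1 := by
  rw [integral_prod _ (integrable_shellDensity_mul Y hf (Y.continuous_val_sphere j).measurable
    (abs_val_sphere_le Y j))]
  have integral_sphere (k : ℕ) :
      ∫ θ : Sphere n, shellDensity Y (k, θ) • (Y.val j θ • f k) ∂(sphereMeasure n) =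
        ({j.1} : Set ℕ).indicator (fun _ => (shellRadius n j.1 ^ j.1)⁻¹ * f j.1) k := by
    simp only [smul_eq_mul, ← mul_assoc]
    rw [integral_mul_const, integral_shellDensity_mul_val]
    by_cases hk : k = j.1
    · simp [hk]
    · simp [hk]
  simp only [integral_sphere]
  rw [integral_indicator_const _ (measurableSet_singleton _)]
  simp [Measure.real]

lemma integrable_shellDensity [NeZero n] (Y : HarmonicBasis n) : Integrable (shellDensity Y)
    ((Measure.count : Measure ℕ).prod (sphereMeasure n)) := by
  have summable_weight : Summable fun k => shellWeight n k * |(1 : ℝ)| := by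
    simpa using summable_shellWeight_mul_pow n 0
  simpa using integrable_shellDensity_mul Y (f := fun _ => 1) summable_weight (g := fun _ => 1)
    measurable_const (c := 1) (by simp)

section Integral

variable [NeZero n] (Y : HarmonicBasis n) {f : ℝ → ℝ} (hfm : Measurable f)
  (hf : Summable fun k => shellWeight n k * |f (shellRadius n k)|) (j : HIndex n)

include hf in
lemma integrable_shell_angular : (((Measure.count : Measure ℕ).prod
    (sphereMeasure n)).withDensityᵥ (shellDensity Y)).Integrable
      ((fun x => Y.angular j x • f ‖x‖) ∘ shellPoint) := by
  refine (integrable_withDensityᵥ_iff (integrable_shellDensity Y) (measurable_shellDensity Y)).2 ?_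
  simpa only [Function.comp_apply, angular_shellPoint, norm_shellPoint] using
    integrable_shellDensity_mul Y (f := fun k => f (shellRadius n k)) hf
      (Y.continuous_val_sphere j).measurable (abs_val_sphere_le Y j)

include hfm hf in
lemma integrable_shellMeasure : (shellMeasure Y).Integrable fun x => Y.angular j x • f ‖x‖ :=
  VectorMeasure.Integrable.map (((Y.measurable_angular j).smul
    (hfm.comp measurable_norm)).aestronglyMeasurable) (integrable_shell_angular Y hf j)

include hfm hf in
lemma integral_shellMeasure : ∫ᵛ x, Y.angular j x • f ‖x‖ ∂<•(shellMeasure Y) =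
    (shellRadius n j.1 ^ j.1)⁻¹ * f (shellRadius n j.1) := by
  have integrable_mul := integrable_shellDensity_mul Y (f := fun k => f (shellRadius n k)) hf
    (Y.continuous_val_sphere j).measurable (abs_val_sphere_le Y j)
  have measurable_smul : Measurable fun x : Space n => Y.angular j x • f ‖x‖ :=
    (Y.measurable_angular j).smul (hfm.comp measurable_norm)
  rw [shellMeasure, VectorMeasure.integral_map measurable_shellPoint
    measurable_smul.aestronglyMeasurable (integrable_shell_angular Y hf j)]
  simp only [angular_shellPoint, norm_shellPoint]
  rw [integral_withDensityᵥ (integrable_shellDensity Y) (measurable_shellDensity Y) integrable_mul,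
    integral_shellDensity_mul Y (f := fun k => f (shellRadius n k)) hf]

end Integral

end Shells

section Counterexample

variable {n : ℕ}

section Components

variable [NeZero n] (Y : HarmonicBasis n)

lemma component_shellMeasure (j : HIndex n) :
    component Y (shellMeasure Y) j = ((Real.toNNReal (shellRadius n j.1 ^ j.1)⁻¹) •
      Measure.dirac (shellRadius n j.1)).toSignedMeasure := by
  ext s hs
  have inv_nonneg : 0 ≤ (shellRadius n j.1 ^ j.1)⁻¹ := by
    have := shellRadius_pos n j.1
    positivity
  have measurable_indicator : Measurable (s.indicator (1 : ℝ → ℝ)) := measurable_one.indicator hs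
  have summable_indicator :
      Summable fun k => shellWeight n k * |s.indicator (1 : ℝ → ℝ) (shellRadius n k)| := by
    refine .of_nonneg_of_le (fun k => mul_nonneg (shellWeight_nonneg n k) (abs_nonneg _))
      (fun k => mul_le_mul_of_nonneg_left ?_ (shellWeight_nonneg n k))
      (summable_shellWeight_mul_pow n 0)
    by_cases h : shellRadius n k ∈ s <;> simp [h]
  have component_apply : component Y (shellMeasure Y) j s =
      (shellRadius n j.1 ^ j.1)⁻¹ * s.indicator 1 (shellRadius n j.1) := by
    rw [← integral_shellMeasure Y measurable_indicator summable_indicator j,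
      ← integral_component Y j measurable_indicator.stronglyMeasurable
        (integrable_shellMeasure Y measurable_indicator summable_indicator j),
      VectorMeasure.integral_indicator hs]
    simp [VectorMeasure.restrict_apply _ hs]
  rw [component_apply, Measure.toSignedMeasure_apply_measurable hs]
  by_cases h : shellRadius n j.1 ∈ s <;> simp [Measure.real, h, hs, inv_nonneg]

lemma compMeasure_shellMeasure (j : HIndex n) :
    compMeasure Y (shellMeasure Y) j = (Real.toNNReal (shellRadius n j.1 ^ j.1)⁻¹) •
      Measure.dirac (shellRadius n j.1) := by
  rw [compMeasure, component_shellMeasure, Measure.variation_toSignedMeasure]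

theorem isPseudoPositive_shellMeasure : IsPseudoPositive Y (shellMeasure Y) := fun j => by
  rw [component_shellMeasure]
  exact Measure.zero_le_toSignedMeasure _

/-- The moments of `shellMeasure`. -/
def shellMoment (n : ℕ) (i : HIndex n) (j : ℕ) : ℝ :=
  (shellRadius n i.1 ^ i.1)⁻¹ * shellRadius n i.1 ^ (i.1 + 2 * j)

theorem solvesMomentProblem_shellMeasure (J : ℕ) :
    SolvesMomentProblem Y (shellMeasure Y) (shellMoment n) J := fun i j _ => by
  have measurable_pow : Measurable fun r : ℝ => r ^ (i.1 + 2 * j) := by fun_prop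
  have summable_pow : Summable fun k => shellWeight n k * |shellRadius n k ^ (i.1 + 2 * j)| := by
    simpa only [abs_of_pos (pow_pos (shellRadius_pos n _) _)] using
      summable_shellWeight_mul_pow n (i.1 + 2 * j)
  simp only [← angular_smul_norm_pow]
  exact ⟨integrable_shellMeasure Y measurable_pow summable_pow i,
    (integral_shellMeasure Y measurable_pow summable_pow i).symm⟩

end Components

theorem growthBound_shellMoment (n : ℕ) : GrowthBound (shellMoment n) 1 1 := fun i => by
  have := shellRadius_pos n i.1
  rw [shellMoment, mul_zero, add_zero, inv_mul_cancel₀ (by positivity)]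
  simp

lemma half_le_norm_scaledRemainder_shellMeasure_sub [NeZero n] (Y : HarmonicBasis n) (M : ℕ)
    (i : HIndex n) {ζ : ℂ} (hζ : ‖ζ‖ = shellRadius n i.1) (one_lt : 1 < shellRadius n i.1)
    (hslit : ∀ t : ℝ, 0 ≤ t → ζ ^ 2 ≠ (t : ℂ)) :
    1 / 2 ≤ ‖scaledRemainder Y (shellMeasure Y) (shellMoment n) M i ζ -
      (shellMoment n i M : ℂ)‖ := by
  rw [(solvesMomentProblem_shellMeasure Y M).scaledRemainder_sub (isPseudoPositive_shellMeasure Y)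
    zero_le_one zero_le_one (growthBound_shellMoment n) (hζ ▸ one_lt) hslit i le_rfl,
    compMeasure_shellMeasure, integral_smul_nnreal_measure, integral_dirac]
  have radius_pos := shellRadius_pos n i.1
  set r := shellRadius n i.1
  have norm_le : ‖ζ ^ 2 - (r : ℂ) ^ 2‖ ≤ 2 * r ^ 2 := by
    refine (norm_sub_le _ _).trans_eq ?_
    rw [norm_pow, norm_pow, hζ, Complex.norm_real, Real.norm_of_nonneg radius_pos.le, two_mul]
  have norm_pos : 0 < ‖ζ ^ 2 - (r : ℂ) ^ 2‖ := by
    rw [norm_pos_iff, sub_ne_zero, ← Complex.ofReal_pow]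
    exact hslit _ (sq_nonneg r)
  rw [NNReal.smul_def, norm_smul, norm_div, norm_pow, Complex.norm_real,
    Real.norm_of_nonneg radius_pos.le, Real.norm_of_nonneg (NNReal.coe_nonneg _),
    Real.coe_toNNReal _ (by positivity)]
  calc (1 / 2 : ℝ) ≤ 1 / 2 * r ^ (2 * M) :=
        le_mul_of_one_le_right (by norm_num) (one_le_pow₀ one_lt.le)
    _ = (r ^ i.1)⁻¹ * (r ^ (i.1 + 2 * (M + 1)) / (2 * r ^ 2)) := by
        rw [mul_add, pow_add, pow_add]
        field_simp
    _ ≤ (r ^ i.1)⁻¹ * (r ^ (i.1 + 2 * (M + 1)) / ‖ζ ^ 2 - (r : ℂ) ^ 2‖) := by gcongr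

lemma exists_norm_eq_arg_sq_eq_pi_div_two {r : ℝ} (hr : 0 < r) :
    ∃ ζ : ℂ, ‖ζ‖ = r ∧ (ζ ^ 2).arg = Real.pi / 2 := by
  refine ⟨r * Complex.exp ((Real.pi / 4 : ℝ) * Complex.I), ?_, ?_⟩
  · rw [norm_mul, Complex.norm_exp_ofReal_mul_I, mul_one, Complex.norm_real,
      Real.norm_of_nonneg hr.le]
  · have double_angle : ((2 : ℕ) : ℂ) * (((Real.pi / 4 : ℝ) : ℂ) * Complex.I) =
        Real.pi / 2 * Complex.I := by
      push_cast
      ring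
    rw [mul_pow, ← Complex.exp_nat_mul, double_angle, Complex.exp_pi_div_two_mul_I,
      ← Complex.ofReal_pow, Complex.arg_real_mul _ (by positivity), Complex.arg_I]

theorem not_uniform_shellMeasure (hn : 2 ≤ n) (Y : HarmonicBasis n) (M : ℕ) {δ : ℝ}
    (hδ : 0 < δ) (hδ' : δ < Real.pi / 2) :
    ¬ ∀ ε : ℝ, 0 < ε → ∃ ρ : ℝ, ∀ i : HIndex n, ∀ ζ ∈ sector δ, ρ < ‖ζ‖ →
      ‖scaledRemainder Y (shellMeasure Y) (shellMoment n) M i ζ -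
        (shellMoment n i M : ℂ)‖ < ε := by
  have : NeZero n := ⟨by omega⟩
  intro uniform
  obtain ⟨ρ, hρ⟩ := uniform (1 / 2) (by norm_num)
  obtain ⟨k, hk⟩ := pow_unbounded_of_one_lt (max ρ 1) (one_lt_two (α := ℝ))
  obtain ⟨lt_radius, one_lt_radius⟩ := max_lt_iff.1 (hk.trans_le (two_pow_le_shellRadius n k))
  obtain ⟨ζ, norm_eq, arg_eq⟩ := exists_norm_eq_arg_sq_eq_pi_div_two (shellRadius_pos n k)
  have mem_sector : ζ ∈ sector δ :=
    ⟨arg_eq ▸ hδ'.le, by linarith [arg_eq]⟩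
  exact (hρ ⟨k, ⟨0, harmonicDim_pos hn Y k⟩⟩ ζ mem_sector (norm_eq ▸ lt_radius)).not_ge
    (half_le_norm_scaledRemainder_shellMeasure_sub Y M _ norm_eq one_lt_radius
      (sq_ne_of_mem_sector hδ mem_sector))

end Counterexample

end KleinDirac

end

theorem mainTheorem1 (n : ℕ) (hn : 2 ≤ n) (Y : KleinDirac.HarmonicBasis n) (N : ℕ) :
    (∀ (μ : SignedMeasure (KleinDirac.Space n)) (s : KleinDirac.HIndex n → ℕ → ℝ) (C D : ℝ),
      KleinDirac.IsPseudoPositive Y μ →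
      KleinDirac.SolvesMomentProblem Y μ s (2 * N) →
      0 < C → 0 < D → KleinDirac.GrowthBound s C D →
      -- the truncations of the measure: here the transform is the integral of the kernel
      (∀ R : ℝ, 0 < R →
        (∀ ζ : ℂ, R < ‖ζ‖ → ∀ θ : KleinDirac.Sphere n,
          (KleinDirac.truncation μ R).Integrable (KleinDirac.kernel ζ θ) ∧
          KleinDirac.TransformConverges Y (KleinDirac.truncation μ R) ζ θ ∧
          KleinDirac.transform Y (KleinDirac.truncation μ R) ζ θ =
            ∫ᵛ x, KleinDirac.kernel ζ θ x ∂<•(KleinDirac.truncation μ R)) ∧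
        KleinDirac.TransformIsNevanlinna Y (KleinDirac.truncation μ R)
          (KleinDirac.KDQ.exterior n R)) ∧
      -- absolute convergence of the transform
      (∀ ζ : ℂ, D < ‖ζ‖ → (∀ t : ℝ, 0 ≤ t → ζ ^ 2 ≠ (t : ℂ)) → ∀ θ : KleinDirac.Sphere n,
        KleinDirac.TransformConverges Y μ ζ θ ∧
        Tendsto (fun R : ℝ => KleinDirac.transform Y (KleinDirac.truncation μ R) ζ θ) atTop
          (𝓝 (KleinDirac.transform Y μ ζ θ))) ∧
      -- membership in the pseudo-positive Nevanlinna class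
      KleinDirac.TransformIsNevanlinna Y μ
        (KleinDirac.KDQ.exterior n D ∩ KleinDirac.KDQ.slit n) ∧
      -- asymptotic expansion, uniform in the sector for each fixed index
      (∀ i : KleinDirac.HIndex n,
        (∀ ζ : ℂ, D < ‖ζ‖ → (∀ t : ℝ, 0 ≤ t → ζ ^ 2 ≠ (t : ℂ)) →
          Integrable (fun θ : KleinDirac.Sphere n =>
            KleinDirac.transform Y μ ζ θ * (Y.val i θ : ℂ)) (KleinDirac.sphereMeasure n)) ∧
        ∀ M ≤ 2 * N, ∀ δ : ℝ, 0 < δ → δ < Real.pi / 2 → ∀ ε : ℝ, 0 < ε →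
          ∃ ρ : ℝ, ∀ ζ ∈ KleinDirac.sector δ, ρ < ‖ζ‖ →
            ‖KleinDirac.scaledRemainder Y μ s M i ζ - (s i M : ℂ)‖ < ε)) ∧
    -- the asymptotic expansion is in general not uniform in the index
    (∃ (μ : SignedMeasure (KleinDirac.Space n)) (s : KleinDirac.HIndex n → ℕ → ℝ) (C D : ℝ),
      KleinDirac.IsPseudoPositive Y μ ∧
      KleinDirac.SolvesMomentProblem Y μ s (2 * N) ∧
      0 < C ∧ 0 < D ∧ KleinDirac.GrowthBound s C D ∧
      ∀ δ : ℝ, 0 < δ → δ < Real.pi / 2 →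
        ¬ ∀ ε : ℝ, 0 < ε → ∃ ρ : ℝ, ∀ i : KleinDirac.HIndex n,
          ∀ ζ ∈ KleinDirac.sector δ, ρ < ‖ζ‖ →
            ‖KleinDirac.scaledRemainder Y μ s (2 * N) i ζ - (s i (2 * N) : ℂ)‖ < ε) := by
  have : NeZero n := ⟨by omega⟩
  refine ⟨fun μ s C D hμ hs hC hD hg => ?_, ?_⟩
  · have hM := hs.momentBound hμ hC.le hD.le hg
    have separated := fun z : ℂ => KleinDirac.isSeparated_rayDist Y μ z
    refine ⟨fun R hR => ⟨fun ζ hζ θ => ?_, hμ.transformIsNevanlinna_truncation hR⟩,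
      fun ζ hζ hslit θ => ?_, hM.transformIsNevanlinna_slit hμ hD,
      fun i => ⟨fun ζ hζ hslit => ?_, fun M hMN δ hδ hδ' ε hε => ?_⟩⟩
    · exact ⟨KleinDirac.integrable_kernel_truncation Y μ hR.le hζ θ,
        hμ.transformConverges_truncation hR.le hζ θ, hμ.transform_truncation_eq hR.le hζ θ⟩
    · have ray_pos := KleinDirac.rayDist_pos hslit
      exact ⟨hM.transformConverges hD.le hζ ray_pos (separated _) θ,
        hM.tendsto_transform_truncation hμ hD.le hζ ray_pos (separated _) θ⟩
    · exact hM.integrable_transform_mul_val hμ hD.le hζ (KleinDirac.rayDist_pos hslit)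
        (separated _) i
    · exact hs.exists_norm_scaledRemainder_sub_lt hμ hC.le hD.le hg i hMN hδ
        (hδ'.trans (half_lt_self Real.pi_pos)) hε
  · exact ⟨KleinDirac.shellMeasure Y, KleinDirac.shellMoment n, 1, 1,
      KleinDirac.isPseudoPositive_shellMeasure Y,
      KleinDirac.solvesMomentProblem_shellMeasure Y (2 * N), one_pos, one_pos,
      KleinDirac.growthBound_shellMoment n,
      fun _ hδ hδ' => KleinDirac.not_uniform_shellMeasure hn Y (2 * N) hδ hδ'⟩
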